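/- There exists a sequence $k_1,k_2,\dots\in\{1,2,3\}$ with the following property. For every infinite-dimensional (real or complex) Hilbert space $H$ and every $0\neq w_0\in H$ there exist three closed subspaces $X_1,X_2,X_3\subset H$ such that, writing $P_i$ for the orthogonal projection of $H$ onto $X_i$, the sequence of iterates defined by $w_n=P_{k_n}w_{n-1}$, $n\geq 1$, does not converge in norm. More precisely, $X_1\cap X_2\cap X_3=\{0\}$, the sequence $(w_n)$ converges weakly to $0$, and there is $c>0$ such that $\|w_n\|\geq c$ for all $n\ge 0$. -/

import Mathlib

open Filter Topology

/-- The iterates of orthogonal projections along an index sequence: starting from `w₀`,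
`w_{n+1}` is the orthogonal projection of `w_n` onto the closed subspace with index `k n`.
So `k n` is the index used in the `(n + 1)`-st step (the `k_{n+1}` of a sequence that starts
with `k₁`), and the three indices are the elements of `Fin 3`. -/
noncomputable def projIterate {𝕜 H : Type*} [RCLike 𝕜] [NormedAddCommGroup H]
    [InnerProductSpace 𝕜 H] [CompleteSpace H]
    (X : Fin 3 → ClosedSubmodule 𝕜 H) (k : ℕ → Fin 3) (w₀ : H) : ℕ → H
  | 0 => w₀
  | n + 1 => (X (k n)).toSubmodule.starProjection (projIterate X k w₀ n)

/-!
The three subspaces are called `E = X 0`, `F = X 1` and `G = X 2` below.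

*Moving a vector.* Let `e₀, e₁, …` be an orthonormal basis of `E`. The vector is carried from `e_m`
to `e_{m+1}` along unit vectors `h_{m,0} = e_m, h_{m,1}, …, h_{m,K} = e_{m+1}` that divide the right
angle into `K = 2 ^ (m + 4)` equal parts; this is the gadget `m`, and its steps are its slots. Each
step loses only `O(1 / K²)` of the
norm, so that the total loss is summable. A step replaces `h_{m,j}` by its projection onto the
orthogonal complement of a unit vector `g_t` of the plane of `e_m, e_{m+1}`, where `t = (m, j)`.
All these projections have to be produced, approximately, by words in just three projections.

*Two scales.* There are orthonormal vectors `x_t`, indexed by the slots, whose projections to `E`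
are `√β_t g_t`, and `F`, `G` are such that `P_F P_G` multiplies `x_t` by `λ_t < 1` and fixes
the vectors of `F` that are orthogonal to all `x_t`. Hence, on `E`,
`P_E (P_F P_G) ^ s = 1 - ∑ₜ (1 - λ_t ^ s) β_t g_t g_t*`. If `λ_t ^ s` is close to `0` for a slot
`t`, and if every other slot `i` has either `β_i` much smaller than `β_t` or `λ_i ^ s` close to `1`,
then this operator is close to `1 - β_t g_t g_t*`, and a high power of it is close to the wanted
projection. So the slots have to be ordered by increasing `λ`, in order type `ω`, with `β`
increasing rapidly, which is impossible for a bounded sequence. But only slots of adjacent gadgets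
interact, since otherwise `g_i` is orthogonal to the plane in question. Letting all odd
gadgets have a small `β` and a position before their even neighbours avoids the obstruction
(`slot_order`, `exists_parameters`). The lemmas `SlotFrame.norm_slotWord_sub_le` and
`SlotFrame.norm_prefixWord_sub_le` turn the choice of parameters into a lower bound for the norms.

*Weak convergence.* The squares of the norms of the iterates decrease, so consecutive iterates get
close to each other. As every three consecutive letters contain both `1` and `2`, the iterates are
asymptotically orthogonal to `Fᗮ` and `Gᗮ`. Right after an application of `P_E` they are orthogonal
to `Eᗮ`, and `Eᗮ + Fᗮ + Gᗮ` is dense because `E ∩ F ∩ G = 0`; between two applications of `P_E` the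
inner products with vectors of `F ∩ G` do not change (`tendsto_inner_projIterate`).
-/

/-! ### Scales -/

/-- A rapidly decreasing sequence `μ` with exponents `s`: the power `s l` is large enough to make
`(1 - μ l) ^ s l` small, and yet `(1 - μ n) ^ s l` stays close to `1` for all later `n`. It is used
once for the coefficients `β`, with the number of repetitions as exponent, and once for `1 - λ`. -/
theorem exists_scales (τ ν : ℕ → ℝ) (hτ : ∀ n, 0 < τ n) (hν : ∀ n, 0 < ν n) :
    ∃ (μ : ℕ → ℝ) (s : ℕ → ℕ), (∀ n, 0 < μ n ∧ μ n ≤ ν n ∧ μ n ≤ 1 / 2) ∧ (∀ n, 1 ≤ s n) ∧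
      (∀ n, (1 - μ n) ^ s n ≤ τ n) ∧ ∀ l n, l < n → s l * μ n ≤ τ l := by
  -- Each `s n` depends on `μ n` only, and `μ (n + 1)` is chosen after `s n`.
  let S : ℕ → ℝ → ℕ := fun n x => ⌈1 / (τ n * x)⌉₊
  let μ : ℕ → ℝ := fun n => Nat.rec (min (ν 0) (1 / 2))
    (fun n x => min x (min (τ n / S n x) (ν (n + 1)))) n
  have hsucc : ∀ n, μ (n + 1) = min (μ n) (min (τ n / S n (μ n)) (ν (n + 1))) := fun n => rfl
  have hS : ∀ n x, 0 < x → 0 < S n x := fun n x hx =>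
    Nat.ceil_pos.2 (one_div_pos.2 (mul_pos (hτ n) hx))
  have hpos : ∀ n, 0 < μ n := by
    intro n
    induction n with
    | zero => exact lt_min (hν 0) (by norm_num)
    | succ n ih =>
      rw [hsucc]
      exact lt_min ih (lt_min (div_pos (hτ n) (Nat.cast_pos.2 (hS n _ ih))) (hν _))
  have hanti : Antitone μ := antitone_nat_of_succ_le fun n => by
    rw [hsucc]; exact min_le_left _ _
  refine ⟨μ, fun n => S n (μ n), fun n => ⟨hpos n, ?_, ?_⟩, fun n => hS n _ (hpos n), ?_, ?_⟩
  · cases n with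
    | zero => exact min_le_left _ _
    | succ n => rw [hsucc]; exact (min_le_right _ _).trans (min_le_right _ _)
  · exact (hanti (Nat.zero_le n)).trans (min_le_right _ _)
  · intro n
    have h1 : 1 / τ n ≤ S n (μ n) * μ n := by
      have := Nat.le_ceil (1 / (τ n * μ n))
      calc 1 / τ n = 1 / (τ n * μ n) * μ n := by
            have := (hpos n).ne'; field_simp
        _ ≤ _ := mul_le_mul_of_nonneg_right this (hpos n).le
    have h2 : μ n ≤ 1 := (hanti (Nat.zero_le n)).trans ((min_le_right _ _).trans (by norm_num))
    calc (1 - μ n) ^ S n (μ n) ≤ Real.exp (-μ n) ^ S n (μ n) :=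
          pow_le_pow_left₀ (by linarith) (Real.one_sub_le_exp_neg _) _
      _ = (Real.exp (S n (μ n) * μ n))⁻¹ := by
          rw [← Real.exp_nat_mul, ← Real.exp_neg]; ring_nf
      _ ≤ (1 / τ n)⁻¹ := by
          apply inv_anti₀ (one_div_pos.2 (hτ n))
          linarith [Real.add_one_le_exp (S n (μ n) * μ n)]
      _ = τ n := by simp
  · intro l n hln
    have h1 : μ n ≤ τ l / S l (μ l) :=
      (hanti (Nat.succ_le_of_lt hln)).trans (by
        rw [hsucc]; exact (min_le_right _ _).trans (min_le_left _ _))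
    have h2 : (0 : ℝ) < S l (μ l) := Nat.cast_pos.2 (hS l _ (hpos l))
    rw [le_div_iff₀ h2] at h1
    linarith

/-- Countably many positive tolerances indexed by pairs can be replaced by tolerances depending on
any one index that dominates both entries of the pair. -/
theorem exists_tolerance (f : ℕ × ℕ → ℝ) (hf : ∀ t, 0 < f t) :
    ∃ τ : ℕ → ℝ, (∀ n, 0 < τ n) ∧ ∀ n m j, m ≤ n → j ≤ n → τ n ≤ f (m, j) := by
  have hne : ∀ n, (Finset.range (n + 1) ×ˢ Finset.range (n + 1)).Nonempty := fun n =>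
    ⟨(0, 0), by simp⟩
  refine ⟨fun n => (Finset.range (n + 1) ×ˢ Finset.range (n + 1)).inf' (hne n) f, fun n => ?_,
    fun n m j hm hj => Finset.inf'_le _ (by simp; omega)⟩
  rw [Finset.lt_inf'_iff]
  exact fun t _ => hf t

/-- The number of steps by which the gadget `m` turns `e m` into `e (m + 1)`. A slot is a pair
`(m, j)`; it belongs to the gadget `m`, and is in use only if `j < gadgetLen m`. -/
def gadgetLen (m : ℕ) : ℕ := 2 ^ (m + 4)

theorem gadgetLen_succ (m : ℕ) : gadgetLen (m + 1) = 2 * gadgetLen m := by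
  simp only [gadgetLen]; ring

theorem gadgetLen_pos (m : ℕ) : 0 < gadgetLen m := by
  simp [gadgetLen]

theorem le_gadgetLen (m : ℕ) : m ≤ gadgetLen m :=
  (Nat.lt_two_pow_self.le.trans (Nat.pow_le_pow_right (by norm_num) (by omega)))

/-- The slots in use of the gadgets `m - 1`, `m` and `m + 1`: those that interact with the plane
spanned by `e m` and `e (m + 1)`. -/
def nearSlots (m : ℕ) : Finset (ℕ × ℕ) :=
  (Finset.range (m + 2) ×ˢ Finset.range (gadgetLen (m + 1))).filter
    fun i => m ≤ i.1 + 1 ∧ i.2 < gadgetLen i.1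

theorem mem_nearSlots {m : ℕ} {i : ℕ × ℕ} :
    i ∈ nearSlots m ↔ i.1 ≤ m + 1 ∧ m ≤ i.1 + 1 ∧ i.2 < gadgetLen i.1 := by
  simp only [nearSlots, Finset.mem_filter, Finset.mem_product, Finset.mem_range]
  constructor
  · rintro ⟨⟨h1, h2⟩, h3, h4⟩
    exact ⟨by omega, h3, h4⟩
  · rintro ⟨h1, h2, h3⟩
    refine ⟨⟨by omega, h3.trans_le ?_⟩, h2, h3⟩
    exact Nat.pow_le_pow_right (by norm_num) (by omega)

/-- The place of a slot in the order by increasing `λ`. Within a gadget it increases with `j`;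
a gadget with odd index comes before its two even neighbours. -/
def slotPos (t : ℕ × ℕ) : ℕ :=
  if Even t.1 then 4 * gadgetLen t.1 + t.2 else gadgetLen t.1 + t.2

/-- The place of a slot in the order by decreasing `β`; on adjacent gadgets it is opposite
to `slotPos`. -/
def slotRank (t : ℕ × ℕ) : ℕ :=
  if Even t.1 then 2 * gadgetLen t.1 - t.2 else 8 * gadgetLen t.1 - t.2

/-- Among slots of adjacent gadgets, the orders by `slotPos` and by `slotRank` are opposite. This
fails for the set of all slots, as no infinite subset of `ℕ` has its order reversed in `ℕ`. -/
theorem slot_order {t i : ℕ × ℕ} (ht : t.2 < gadgetLen t.1) (hi : i ∈ nearSlots t.1)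
    (hne : i ≠ t) :
    (slotPos i < slotPos t ∧ slotRank t < slotRank i) ∨
      (slotPos t < slotPos i ∧ slotRank i < slotRank t) := by
  obtain ⟨m, j⟩ := t
  obtain ⟨m', j'⟩ := i
  rw [mem_nearSlots] at hi
  obtain ⟨h1, h2, h3⟩ := hi
  simp only [slotPos, slotRank] at *
  have hcases : m' = m ∨ m' = m + 1 ∨ m = m' + 1 := by omega
  rcases hcases with rfl | rfl | rfl
  · have : j' ≠ j := fun h => hne (by rw [h])
    split_ifs <;> omega
  · rw [gadgetLen_succ] at *
    by_cases h : Even m <;>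
      simp only [Nat.even_add_one, h, not_true, not_false_iff, if_true, if_false] <;> omega
  · rw [gadgetLen_succ] at *
    by_cases h : Even m' <;>
      simp only [Nat.even_add_one, h, not_true, not_false_iff, if_true, if_false] <;> omega

/-- The choice of all numerical parameters. The last condition bounds `r t` times the distance
between `P_E (P_F P_G) ^ s t` and `1 - β t g_t g_t*` on the plane of the gadget of `t`. -/
theorem exists_parameters (ε : ℕ → ℝ) (hε : ∀ m, 0 < ε m) :
    ∃ (β lam : ℕ × ℕ → ℝ) (s r : ℕ × ℕ → ℕ),
      (∀ t, 0 < β t ∧ β t ≤ 1) ∧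
      (∀ t : ℕ × ℕ, t.2 < gadgetLen t.1 → β t ≤ 1 / (4 * gadgetLen t.1)) ∧
      (∀ t, 0 < lam t ∧ lam t < 1) ∧ (∀ t, 1 ≤ s t) ∧ (∀ t, 1 ≤ r t) ∧
      ∀ t : ℕ × ℕ, t.2 < gadgetLen t.1 →
        (1 - β t) ^ r t ≤ ε t.1 ∧
        r t * (lam t ^ s t * β t +
          ∑ i ∈ (nearSlots t.1).erase t, (1 - lam i ^ s t) * β i) ≤ ε t.1 := by
  set N : ℕ → ℝ := fun m => (nearSlots m).card + 1
  have hNpos : ∀ m, 0 < N m := fun m => by positivity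
  obtain ⟨τ, hτ, hτf⟩ := exists_tolerance (fun t => min (ε t.1) (ε t.1 / N t.1))
    fun t => lt_min (hε _) (div_pos (hε _) (hNpos _))
  obtain ⟨ν, hν, hνf⟩ := exists_tolerance (fun t => 1 / (4 * gadgetLen t.1))
    fun t => by have := gadgetLen_pos t.1; positivity
  obtain ⟨ω, R, hω, hR, hωR, hωτ⟩ := exists_scales τ ν hτ hν
  have hRpos : ∀ n, (0 : ℝ) < R n := fun n => Nat.cast_pos.2 (hR n)
  obtain ⟨τ', hτ', hτf'⟩ := exists_tolerance (fun t => ε t.1 / N t.1 / R (slotRank t))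
    fun t => div_pos (div_pos (hε _) (hNpos _)) (hRpos _)
  obtain ⟨μ, s, hμ, hs, hμs, hμτ⟩ := exists_scales τ' 1 hτ' fun _ => one_pos
  have hrank : ∀ t : ℕ × ℕ, t.2 < gadgetLen t.1 → t.1 ≤ slotRank t ∧ t.2 ≤ slotRank t := by
    intro t ht
    have := le_gadgetLen t.1
    simp only [slotRank]
    split_ifs <;> omega
  have hpos : ∀ t : ℕ × ℕ, t.1 ≤ slotPos t ∧ t.2 ≤ slotPos t := by
    intro t
    have := le_gadgetLen t.1
    simp only [slotPos]
    split_ifs <;> omega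
  refine ⟨fun t => ω (slotRank t), fun t => 1 - μ (slotPos t), fun t => s (slotPos t),
    fun t => R (slotRank t), fun t => ⟨(hω _).1, (hω _).2.2.trans (by norm_num)⟩, fun t ht => ?_,
    fun t => ⟨by linarith [(hμ (slotPos t)).2.2], by linarith [(hμ (slotPos t)).1]⟩,
    fun t => hs _, fun t => hR _, fun t ht => ⟨?_, ?_⟩⟩
  · exact (hω _).2.1.trans (hνf _ t.1 t.2 (hrank t ht).1 (hrank t ht).2)
  · exact (hωR _).trans ((hτf _ t.1 t.2 (hrank t ht).1 (hrank t ht).2).trans (min_le_left _ _))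
  · have hR0 := hRpos (slotRank t)
    have hτ1 : τ (slotRank t) ≤ ε t.1 / N t.1 :=
      (hτf _ t.1 t.2 (hrank t ht).1 (hrank t ht).2).trans (min_le_right _ _)
    have hτ2 : R (slotRank t) * τ' (slotPos t) ≤ ε t.1 / N t.1 := by
      have := hτf' _ t.1 t.2 (hpos t).1 (hpos t).2
      rwa [le_div_iff₀ hR0, mul_comm] at this
    have hterm : ∀ i ∈ (nearSlots t.1).erase t,
        R (slotRank t) * ((1 - (1 - μ (slotPos i)) ^ s (slotPos t)) * ω (slotRank i))
          ≤ ε t.1 / N t.1 := by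
      intro i hi
      rw [Finset.mem_erase] at hi
      have hμi := hμ (slotPos i)
      have hωi := hω (slotRank i)
      have hpow0 : (0 : ℝ) ≤ (1 - μ (slotPos i)) ^ s (slotPos t) :=
        pow_nonneg (by linarith) _
      have hpow1 : (1 - μ (slotPos i)) ^ s (slotPos t) ≤ 1 :=
        pow_le_one₀ (by linarith) (by linarith)
      -- An earlier slot has a negligible `β`; for a later one, `λ ^ s t` is close to `1`.
      rcases slot_order ht hi.2 hi.1 with ⟨-, h⟩ | ⟨h, -⟩
      · calc _ ≤ R (slotRank t) * (1 * ω (slotRank i)) := by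
              apply mul_le_mul_of_nonneg_left _ hR0.le
              apply mul_le_mul_of_nonneg_right _ hωi.1.le
              linarith
          _ ≤ τ (slotRank t) := by rw [one_mul]; exact hωτ _ _ h
          _ ≤ _ := hτ1
      · have hb : 1 - s (slotPos t) * μ (slotPos i) ≤ (1 - μ (slotPos i)) ^ s (slotPos t) := by
          have := one_add_mul_le_pow (a := -μ (slotPos i)) (by linarith) (s (slotPos t))
          rw [← sub_eq_add_neg] at this
          linarith
        calc _ ≤ R (slotRank t) * (τ' (slotPos t) * 1) := by
              apply mul_le_mul_of_nonneg_left _ hR0.le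
              apply mul_le_mul _ _ hωi.1.le (hτ' _).le
              · linarith [hμτ _ _ h]
              · linarith
          _ ≤ _ := by rw [mul_one]; exact hτ2
    have hmain : R (slotRank t) * ((1 - μ (slotPos t)) ^ s (slotPos t) * ω (slotRank t))
        ≤ ε t.1 / N t.1 := by
      have hωi := hω (slotRank t)
      calc _ ≤ R (slotRank t) * (τ' (slotPos t) * 1) := by
              apply mul_le_mul_of_nonneg_left _ hR0.le
              apply mul_le_mul (hμs _) _ hωi.1.le (hτ' _).le
              linarith
          _ ≤ _ := by rw [mul_one]; exact hτ2
    have hmem : ε t.1 / N t.1 * N t.1 = ε t.1 := div_mul_cancel₀ _ (hNpos _).ne'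
    rw [mul_add, Finset.mul_sum]
    have hsum := Finset.sum_le_card_nsmul _ _ _ hterm
    have hcard : (((nearSlots t.1).erase t).card : ℝ) ≤ (nearSlots t.1).card := by
      exact_mod_cast Finset.card_erase_le
    rw [nsmul_eq_mul] at hsum
    have hq : 0 < ε t.1 / N t.1 := div_pos (hε _) (hNpos _)
    have : (((nearSlots t.1).erase t).card : ℝ) * (ε t.1 / N t.1) ≤
      (nearSlots t.1).card * (ε t.1 / N t.1) := mul_le_mul_of_nonneg_right hcard hq.le
    have hNt : N t.1 = (nearSlots t.1).card + 1 := rfl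
    rw [hNt] at hmem this hsum hmain
    beta_reduce
    linarith

/-! ### Words -/

/-- The transitions between consecutive letters that occur in the sequence: `0 → 2`, `2 → 1`,
`1 → 2` and `1 → 0`. -/
def Follows (a b : Fin 3) : Prop := (b = 1 ↔ a = 2) ∧ a ≠ b

/-- Words with admissible transitions that, if not empty, begin with `2` and end with `0`. They
can be concatenated. -/
def IsBlock (l : List (Fin 3)) : Prop :=
  l.IsChain Follows ∧ (∀ a ∈ l.getLast?, a = 0) ∧ ∀ b ∈ l.head?, b = 2

theorem IsBlock.append {l l' : List (Fin 3)} (h : IsBlock l) (h' : IsBlock l') :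
    IsBlock (l ++ l') := by
  refine ⟨List.isChain_append.2 ⟨h.1, h'.1, fun a ha b hb => ?_⟩, fun a ha => ?_, fun b hb => ?_⟩
  · rw [h.2.1 a ha, h'.2.2 b hb]; unfold Follows; decide
  · rw [List.getLast?_append] at ha
    rcases hl : l'.getLast? with _ | c
    · rw [hl] at ha; exact h.2.1 a (by simpa using ha)
    · rw [hl] at ha; exact h'.2.1 a (by rw [hl]; simpa using ha)
  · rw [List.head?_append] at hb
    rcases hl : l.head? with _ | c
    · rw [hl] at hb; exact h'.2.2 b (by simpa using hb)
    · rw [hl] at hb; exact h.2.2 b (by rw [hl]; simpa using hb)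

theorem IsBlock.flatten {L : List (List (Fin 3))} (h : ∀ l ∈ L, IsBlock l) :
    IsBlock L.flatten := by
  induction L with
  | nil => exact ⟨by simp, by simp, by simp⟩
  | cons l L ih =>
    rw [List.flatten_cons]
    exact (h l (by simp)).append (ih fun l' hl' => h l' (by simp [hl']))

/-- The word of `P_E (P_F P_G) ^ s`; the letters of a word are applied from left to right. -/
def cycleWord (s : ℕ) : List (Fin 3) := (List.replicate s [2, 1]).flatten ++ [0]

theorem isBlock_cycleWord (s : ℕ) (hs : 1 ≤ s) : IsBlock (cycleWord s) := by
  induction s, hs using Nat.le_induction with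
  | base =>
    refine ⟨?_, ?_, ?_⟩ <;> simp [cycleWord, Follows]
  | succ s hs ih =>
    have : cycleWord (s + 1) = 2 :: 1 :: cycleWord s := by
      simp [cycleWord, List.replicate_succ]
    rw [this]
    obtain ⟨s, rfl⟩ : ∃ s', s = s' + 1 := ⟨s - 1, by omega⟩
    have h2 : cycleWord (s + 1) = 2 :: 1 :: cycleWord s := by
      simp [cycleWord, List.replicate_succ]
    rw [h2] at ih ⊢
    refine ⟨?_, ?_, by simp⟩
    · have := ih.1
      simp only [List.isChain_cons_cons] at this ⊢
      exact ⟨by simp [Follows], by simp [Follows], this⟩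
    · intro a ha
      exact ih.2.1 a (by simpa [List.getLast?_cons_cons] using ha)

/-- The word that projects approximately onto the orthogonal complement of one `g_t`. -/
def slotWord (s r : ℕ) : List (Fin 3) := (List.replicate r (cycleWord s)).flatten

/-- The word that moves `e m` approximately to `e (m + 1)`. -/
def gadgetWord (s r : ℕ × ℕ → ℕ) (m : ℕ) : List (Fin 3) :=
  ((List.range (gadgetLen m)).map fun j => slotWord (s (m, j)) (r (m, j))).flatten

theorem isBlock_gadgetWord {s : ℕ × ℕ → ℕ} (hs : ∀ t, 1 ≤ s t) (r : ℕ × ℕ → ℕ) (m : ℕ) :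
    IsBlock (gadgetWord s r m) := by
  apply IsBlock.flatten
  intro l hl
  obtain ⟨j, -, rfl⟩ := List.mem_map.1 hl
  apply IsBlock.flatten
  intro l hl
  rw [List.eq_of_mem_replicate hl]
  exact isBlock_cycleWord _ (hs _)

theorem gadgetWord_ne_nil (s : ℕ × ℕ → ℕ) {r : ℕ × ℕ → ℕ} (hr : ∀ t, 1 ≤ r t) (m : ℕ) :
    gadgetWord s r m ≠ [] := by
  intro h
  rw [gadgetWord, List.flatten_eq_nil_iff] at h
  have h1 := h _ (List.mem_map.2 ⟨0, List.mem_range.2 (gadgetLen_pos m), rfl⟩)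
  rw [slotWord, List.flatten_eq_nil_iff] at h1
  have h2 := h1 (cycleWord (s (m, 0))) (List.mem_replicate.2 ⟨by have := hr (m, 0); omega, rfl⟩)
  simp [cycleWord] at h2

/-- The initial part of the sequence up to the gadget `m`, exclusive. The first letter `0`
replaces the given starting vector by a multiple of `e 0`. -/
def prefixWord (s r : ℕ × ℕ → ℕ) : ℕ → List (Fin 3)
  | 0 => [0]
  | m + 1 => prefixWord s r m ++ gadgetWord s r m

theorem prefixWord_length_lt (s : ℕ × ℕ → ℕ) {r : ℕ × ℕ → ℕ} (hr : ∀ t, 1 ≤ r t) (m : ℕ) :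
    m < (prefixWord s r m).length := by
  induction m with
  | zero => simp [prefixWord]
  | succ m ih =>
    have := List.length_pos_of_ne_nil (gadgetWord_ne_nil s hr m)
    simp only [prefixWord, List.length_append]
    omega

theorem prefixWord_prefix (s r : ℕ × ℕ → ℕ) {m n : ℕ} (h : m ≤ n) :
    prefixWord s r m <+: prefixWord s r n := by
  induction n, h using Nat.le_induction with
  | base => exact List.prefix_rfl
  | succ n hn ih => exact ih.trans (List.prefix_append _ _)

theorem prefixWord_chain {s : ℕ × ℕ → ℕ} (hs : ∀ t, 1 ≤ s t) (r : ℕ × ℕ → ℕ) (m : ℕ) :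
    (prefixWord s r m).IsChain Follows ∧ ∀ a ∈ (prefixWord s r m).getLast?, a = 0 := by
  induction m with
  | zero => simp [prefixWord]
  | succ m ih =>
    have h := isBlock_gadgetWord hs r m
    refine ⟨List.isChain_append.2 ⟨ih.1, h.1, fun a ha b hb => ?_⟩, fun a ha => ?_⟩
    · rw [ih.2 a ha, h.2.2 b hb]; unfold Follows; decide
    · rw [prefixWord, List.getLast?_append] at ha
      rcases hl : (gadgetWord s r m).getLast? with _ | c
      · rw [hl] at ha; exact ih.2 a (by simpa using ha)
      · rw [hl] at ha; exact h.2.1 a (by rw [hl]; simpa using ha)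

/-- The infinite sequence of letters with the initial parts `prefixWord s r m`. The default
value of `getD` is never attained, by `prefixWord_length_lt`. -/
def letters (s r : ℕ × ℕ → ℕ) (n : ℕ) : Fin 3 := (prefixWord s r n).getD n 0

theorem letters_eq (s : ℕ × ℕ → ℕ) {r : ℕ × ℕ → ℕ} (hr : ∀ t, 1 ≤ r t) (m n : ℕ)
    (hn : n < (prefixWord s r m).length) : letters s r n = (prefixWord s r m)[n] := by
  have hn' := prefixWord_length_lt s hr n
  rw [letters, List.getD_eq_getElem _ _ hn']
  rcases le_total m n with h | h
  · exact ((prefixWord_prefix s r h).getElem hn).symm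
  · exact (prefixWord_prefix s r h).getElem hn'

theorem letters_follows {s r : ℕ × ℕ → ℕ} (hs : ∀ t, 1 ≤ s t) (hr : ∀ t, 1 ≤ r t) (n : ℕ) :
    Follows (letters s r n) (letters s r (n + 1)) := by
  have h := prefixWord_length_lt s hr (n + 1)
  rw [letters_eq s hr (n + 1) n (by omega), letters_eq s hr (n + 1) (n + 1) h]
  exact List.isChain_iff_getElem.1 (prefixWord_chain hs r (n + 1)).1 n h

theorem exists_letters_eq_zero {s r : ℕ × ℕ → ℕ} (hs : ∀ t, 1 ≤ s t) (hr : ∀ t, 1 ≤ r t) (n : ℕ) :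
    ∃ i ≥ n, letters s r i = 0 := by
  have h := prefixWord_length_lt s hr n
  refine ⟨(prefixWord s r n).length - 1, by omega, ?_⟩
  rw [letters_eq s hr n _ (by omega)]
  apply (prefixWord_chain hs r n).2
  rw [List.getLast?_eq_getElem?]
  simp

section Action

variable {𝕜 H : Type*} [RCLike 𝕜] [NormedAddCommGroup H] [InnerProductSpace 𝕜 H] [CompleteSpace H]

/-- The product of the projections given by a finite word, applied to a vector. -/
noncomputable def wordAction (X : Fin 3 → ClosedSubmodule 𝕜 H) (l : List (Fin 3)) (v : H) : H :=
  l.foldl (fun u i => (X i).toSubmodule.starProjection u) v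

theorem wordAction_append (X : Fin 3 → ClosedSubmodule 𝕜 H) (l l' : List (Fin 3)) (v : H) :
    wordAction X (l ++ l') v = wordAction X l' (wordAction X l v) := by
  simp [wordAction]

theorem norm_wordAction_sub_le (X : Fin 3 → ClosedSubmodule 𝕜 H) (l : List (Fin 3)) (u v : H) :
    ‖wordAction X l u - wordAction X l v‖ ≤ ‖u - v‖ := by
  induction l generalizing u v with
  | nil => simp [wordAction]
  | cons i l ih =>
    refine (ih _ _).trans ?_
    rw [← map_sub]
    exact Submodule.norm_starProjection_apply_le _ _

theorem wordAction_replicate (X : Fin 3 → ClosedSubmodule 𝕜 H) (l : List (Fin 3)) (n : ℕ) (v : H) :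
    wordAction X (List.replicate n l).flatten v = (wordAction X l)^[n] v := by
  induction n generalizing v with
  | zero => simp [wordAction]
  | succ n ih =>
    rw [List.replicate_succ, List.flatten_cons, wordAction_append, ih, Function.iterate_succ_apply]

theorem projIterate_eq_wordAction (X : Fin 3 → ClosedSubmodule 𝕜 H) (k : ℕ → Fin 3) (w : H)
    (l : List (Fin 3)) (h : ∀ (n : ℕ) (hn : n < l.length), k n = l[n]) :
    projIterate X k w l.length = wordAction X l w := by
  induction l using List.reverseRecOn with
  | nil => simp [wordAction, projIterate]
  | append_singleton l i ih =>
    have h1 := ih fun n hn => by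
      rw [h n (by simp; omega), List.getElem_append_left hn]
    have h2 := h l.length (by simp)
    rw [List.getElem_concat_length rfl] at h2
    rw [List.length_append, List.length_singleton, projIterate, h1, wordAction_append]
    have key : ∀ (j : Fin 3) (u : H), j = i →
        (X j).toSubmodule.starProjection u = wordAction X [i] u := by
      rintro _ u rfl; rfl
    exact key _ _ h2

end Action

/-! ### Weak convergence of the iterates -/

section WeakConvergence

variable {𝕜 H : Type*} [RCLike 𝕜] [NormedAddCommGroup H] [InnerProductSpace 𝕜 H] [CompleteSpace H]

/-- A bounded family tends weakly to `0` once the vectors on which it does so have a trivial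
orthogonal complement. -/
theorem tendsto_inner_of_total {ι : Type*} {l : Filter ι} {w : ι → H} {C : ℝ}
    (hC : ∀ n, ‖w n‖ ≤ C)
    (h : ∀ v : H, (∀ u : H, Tendsto (fun n => inner 𝕜 u (w n)) l (𝓝 0) → inner 𝕜 u v = 0) →
      v = 0) (u : H) : Tendsto (fun n => inner 𝕜 u (w n)) l (𝓝 0) := by
  let D : Submodule 𝕜 H :=
    { carrier := {u | Tendsto (fun n => inner 𝕜 u (w n)) l (𝓝 0)}
      add_mem' := fun {a b} ha hb => by
        simpa [inner_add_left] using Tendsto.add (Set.mem_ofPred.1 ha) (Set.mem_ofPred.1 hb)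
      zero_mem' := by simpa using tendsto_const_nhds
      smul_mem' := fun c a ha => by
        simpa [inner_smul_left] using
          Tendsto.const_mul ((starRingEnd 𝕜) c) (Set.mem_ofPred.1 ha) }
  have hD : D.topologicalClosure = ⊤ := by
    rw [Submodule.topologicalClosure_eq_top_iff, Submodule.eq_bot_iff]
    exact fun v hv => h v fun u hu => (Submodule.mem_orthogonal _ _).1 hv u hu
  have hu : u ∈ closure (D : Set H) := by
    rw [← Submodule.topologicalClosure_coe, hD]; trivial
  rw [Metric.tendsto_nhds]
  intro ε hε
  have hC' : 0 < |C| + 1 := by positivity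
  obtain ⟨d, hd, hdu⟩ := Metric.mem_closure_iff.1 hu (ε / 2 / (|C| + 1)) (by positivity)
  filter_upwards [Metric.tendsto_nhds.1 (show Tendsto (fun n => inner 𝕜 d (w n)) l (𝓝 0) from hd)
    (ε / 2) (by positivity)] with n hn
  rw [dist_zero_right] at hn ⊢
  rw [dist_eq_norm] at hdu
  have h1 : ‖inner 𝕜 (u - d) (w n)‖ ≤ ε / 2 := by
    calc _ ≤ ‖u - d‖ * ‖w n‖ := norm_inner_le_norm _ _
      _ ≤ ε / 2 / (|C| + 1) * (|C| + 1) :=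
        mul_le_mul hdu.le ((hC n).trans (by linarith [le_abs_self C])) (norm_nonneg _)
          (by positivity)
      _ = ε / 2 := div_mul_cancel₀ _ hC'.ne'
  calc ‖inner 𝕜 u (w n)‖ = ‖inner 𝕜 (u - d) (w n) + inner 𝕜 d (w n)‖ := by
        rw [inner_sub_left, sub_add_cancel]
    _ ≤ _ := norm_add_le _ _
    _ < ε := by linarith

variable (X : Fin 3 → ClosedSubmodule 𝕜 H) (k : ℕ → Fin 3) (w : H)

theorem norm_projIterate_antitone : Antitone fun n => ‖projIterate X k w n‖ :=
  antitone_nat_of_succ_le fun _ => Submodule.norm_starProjection_apply_le _ _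

theorem projIterate_succ_mem (n : ℕ) : projIterate X k w (n + 1) ∈ (X (k n)).toSubmodule :=
  Submodule.starProjection_apply_mem _ _

/-- Consecutive iterates approach each other, since
`‖wₙ - wₙ₊₁‖² = ‖wₙ‖² - ‖wₙ₊₁‖²` and the norms converge. -/
theorem tendsto_projIterate_sub :
    Tendsto (fun n => ‖projIterate X k w n - projIterate X k w (n + 1)‖) atTop (𝓝 0) := by
  obtain ⟨c, hc⟩ : ∃ c, Tendsto (fun n => ‖projIterate X k w n‖) atTop (𝓝 c) :=
    ⟨_, tendsto_atTop_ciInf (norm_projIterate_antitone X k w)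
      ⟨0, by rintro _ ⟨n, rfl⟩; exact norm_nonneg _⟩⟩
  have h1 : Tendsto (fun n => ‖projIterate X k w n‖ ^ 2 - ‖projIterate X k w (n + 1)‖ ^ 2)
      atTop (𝓝 0) := by
    simpa using (hc.pow 2).sub ((hc.comp (tendsto_add_atTop_nat 1)).pow 2)
  have h2 : ∀ n, ‖projIterate X k w n - projIterate X k w (n + 1)‖ =
      √(‖projIterate X k w n‖ ^ 2 - ‖projIterate X k w (n + 1)‖ ^ 2) := by
    intro n
    rw [(X (k n)).toSubmodule.norm_sq_eq_add_norm_sq_starProjection (projIterate X k w n),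
      Submodule.starProjection_orthogonal_val]
    simp [projIterate]
  simp only [h2]
  simpa using h1.sqrt

theorem exists_letter_near {k : ℕ → Fin 3} (hk : ∀ n, Follows (k n) (k (n + 1))) (n : ℕ) {i : Fin 3}
    (hi : i ≠ 0) : k n = i ∨ k (n + 1) = i ∨ k (n + 2) = i := by
  have h1 := hk n
  have h2 := hk (n + 1)
  revert h1 h2 hi
  rw [show n + 1 + 1 = n + 2 from rfl]
  generalize k n = a, k (n + 1) = b, k (n + 2) = c
  unfold Follows
  revert a b c i
  decide

theorem tendsto_inner_orthogonal {k : ℕ → Fin 3} (hk : ∀ n, Follows (k n) (k (n + 1)))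
    {i : Fin 3} (hi : i ≠ 0) {v : H} (hv : v ∈ (X i).toSubmoduleᗮ) :
    Tendsto (fun n => inner 𝕜 v (projIterate X k w n)) atTop (𝓝 0) := by
  set u := projIterate X k w with hu
  have hd := tendsto_projIterate_sub X k w
  have hlim : Tendsto (fun n => ‖v‖ * (‖u n - u (n + 1)‖ + ‖u (n + 1) - u (n + 2)‖ +
      ‖u (n + 2) - u (n + 3)‖)) atTop (𝓝 0) := by
    simpa using ((hd.add (hd.comp (tendsto_add_atTop_nat 1))).add
      (hd.comp (tendsto_add_atTop_nat 2))).const_mul ‖v‖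
  apply squeeze_zero_norm _ hlim
  intro n
  have key : ∀ n', k n' = i → inner 𝕜 v (u n) = inner 𝕜 v (u n - u (n' + 1)) := by
    intro n' hn'
    have hmem := projIterate_succ_mem X k w n'
    rw [hn'] at hmem
    rw [inner_sub_right, Submodule.inner_left_of_mem_orthogonal hmem hv, sub_zero]
  have bound : ∀ n', k n' = i → ‖inner 𝕜 v (u n)‖ ≤ ‖v‖ * ‖u n - u (n' + 1)‖ := fun n' hn' => by
    rw [key n' hn']; exact norm_inner_le_norm _ _
  have n1 := norm_nonneg (u n - u (n + 1))
  have n2 := norm_nonneg (u (n + 1) - u (n + 2))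
  have n3 := norm_nonneg (u (n + 2) - u (n + 3))
  have t1 := norm_sub_le_norm_sub_add_norm_sub (u n) (u (n + 1)) (u (n + 2))
  have t2 := norm_sub_le_norm_sub_add_norm_sub (u n) (u (n + 2)) (u (n + 3))
  rcases exists_letter_near hk n hi with h | h | h
  · exact (bound _ h).trans (mul_le_mul_of_nonneg_left (by linarith) (norm_nonneg v))
  · have h' : ‖inner 𝕜 v (u n)‖ ≤ ‖v‖ * ‖u n - u (n + 2)‖ := bound _ h
    exact h'.trans (mul_le_mul_of_nonneg_left (by linarith) (norm_nonneg v))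
  · have h' : ‖inner 𝕜 v (u n)‖ ≤ ‖v‖ * ‖u n - u (n + 3)‖ := bound _ h
    exact h'.trans (mul_le_mul_of_nonneg_left (by linarith) (norm_nonneg v))

/-- Weak convergence to `0` of the iterates, for any three closed subspaces with trivial
intersection, if the letters follow each other as in `Follows`, so that every three consecutive ones
contain `1` and `2`, and the letter `0` occurs infinitely often. -/
theorem tendsto_inner_projIterate {k : ℕ → Fin 3} (hk : ∀ n, Follows (k n) (k (n + 1)))
    (h0 : ∀ n, ∃ i ≥ n, k i = 0) (hX : ∀ x : H, (∀ i, x ∈ X i) → x = 0) (v : H) :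
    Tendsto (fun n => inner 𝕜 v (projIterate X k w n)) atTop (𝓝 0) := by
  set u := projIterate X k w with hu
  have hbd : ∀ n, ‖u n‖ ≤ ‖w‖ := fun n => norm_projIterate_antitone X k w (Nat.zero_le n)
  have hclosed : ∀ i (v : H), (∀ u ∈ (X i).toSubmoduleᗮ, inner 𝕜 u v = 0) → v ∈ X i := by
    intro i v hv
    have : v ∈ (X i).toSubmoduleᗮᗮ := (Submodule.mem_orthogonal _ _).2 hv
    rwa [Submodule.orthogonal_orthogonal] at this
  -- The iterates right after a letter `0` already tend weakly to `0`.
  have hE : ∀ v, Tendsto (fun n => inner 𝕜 v (u (n + 1))) (atTop ⊓ 𝓟 {n | k n = 0}) (𝓝 0) := by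
    refine tendsto_inner_of_total (fun n => hbd (n + 1)) fun v hv => hX v fun i => ?_
    refine hclosed i v fun z hz => hv z ?_
    by_cases hi : i = 0
    · refine tendsto_const_nhds.congr' ?_
      filter_upwards [mem_inf_of_right (mem_principal_self _)] with n hn
      have hmem := projIterate_succ_mem X k w n
      rw [show k n = 0 from hn, ← hi] at hmem
      exact (Submodule.inner_left_of_mem_orthogonal hmem hz).symm
    · exact ((tendsto_inner_orthogonal X w hk hi hz).comp (tendsto_add_atTop_nat 1)).mono_left
        inf_le_left
  refine tendsto_inner_of_total hbd (fun v hv => ?_) v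
  have hv1 : ∀ i, i ≠ 0 → v ∈ X i := fun i hi =>
    hclosed i v fun z hz => hv z (tendsto_inner_orthogonal X w hk hi hz)
  -- Such a `v` lies in `X 1 ∩ X 2`, so `inner v (u n)` changes only at the letters `0`.
  refine inner_self_eq_zero.1 (hv v ?_)
  rw [Metric.tendsto_atTop]
  intro ε hε
  have := Metric.tendsto_nhds.1 (hE v) ε hε
  rw [eventually_inf_principal, eventually_atTop] at this
  obtain ⟨N, hN⟩ := this
  obtain ⟨n₀, hn₀, hk₀⟩ := h0 N
  refine ⟨n₀ + 1, fun n hn => ?_⟩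
  induction n, hn using Nat.le_induction with
  | base => exact hN n₀ hn₀ hk₀
  | succ n hn ih =>
    by_cases h : k n = 0
    · exact hN n (by omega) h
    · have : inner 𝕜 v (u (n + 1)) = inner 𝕜 v (u n) := by
        change inner 𝕜 v ((X (k n)).toSubmodule.starProjection (u n)) = _
        rw [← Submodule.inner_starProjection_left_eq_right,
          Submodule.starProjection_eq_self_iff.2 (hv1 _ h)]
      rwa [this]

theorem tendsto_toWeakSpace {u : ℕ → H} (h : ∀ v, Tendsto (fun n => inner 𝕜 v (u n)) atTop (𝓝 0)) :
    Tendsto (fun n => toWeakSpace 𝕜 H (u n)) atTop (𝓝 0) := by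
  have hinj : Function.Injective (topDualPairing 𝕜 H).flip := fun x y hxy =>
    ext_inner_left 𝕜 fun v => by simpa using LinearMap.congr_fun hxy (innerSL 𝕜 v)
  refine (WeakBilin.tendsto_iff_forall_eval_tendsto (topDualPairing 𝕜 H).flip hinj
    (f := fun n => toWeakSpace 𝕜 H (u n)) (x := 0)).2 fun f => ?_
  obtain ⟨v, rfl⟩ := (InnerProductSpace.toDual 𝕜 H).surjective f
  change Tendsto (fun n => inner 𝕜 v (u n)) atTop (𝓝 (inner 𝕜 v (0 : H)))
  rw [inner_zero_right]
  exact h v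

end WeakConvergence

/-! ### The three subspaces -/

section Frame

set_option linter.unusedSectionVars false

variable {𝕜 H : Type*} [RCLike 𝕜] [NormedAddCommGroup H] [InnerProductSpace 𝕜 H] [CompleteSpace H]

variable (𝕜) in
/-- The closed linear span of a family of vectors. -/
def closedSpan {ι : Type*} (e : ι → H) : ClosedSubmodule 𝕜 H :=
  ⟨(Submodule.span 𝕜 (Set.range e)).topologicalClosure, Submodule.isClosed_topologicalClosure _⟩

variable (𝕜) in
/-- The orthogonal complement of a family of vectors. -/
def closedPerp {ι : Type*} (e : ι → H) : ClosedSubmodule 𝕜 H :=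
  ⟨(Submodule.span 𝕜 (Set.range e))ᗮ, Submodule.isClosed_orthogonal _⟩

theorem mem_closedPerp {ι : Type*} {e : ι → H} {v : H} :
    v ∈ (closedPerp 𝕜 e).toSubmodule ↔ ∀ i, inner 𝕜 (e i) v = 0 := by
  change v ∈ (Submodule.span 𝕜 (Set.range e))ᗮ ↔ _
  rw [Submodule.mem_orthogonal]
  refine ⟨fun h i => h _ (Submodule.subset_span ⟨i, rfl⟩), fun h u hu => ?_⟩
  induction hu using Submodule.span_induction with
  | mem u hu => obtain ⟨i, rfl⟩ := hu; exact h i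
  | zero => simp
  | add a b _ _ ha hb => rw [inner_add_left, ha, hb, add_zero]
  | smul c a _ ha => rw [inner_smul_left, ha, mul_zero]

theorem mem_closedSpan {ι : Type*} (e : ι → H) (i : ι) : e i ∈ (closedSpan 𝕜 e).toSubmodule :=
  Submodule.le_topologicalClosure _ (Submodule.subset_span ⟨i, rfl⟩)

theorem mem_closedSpan_orthogonal {ι : Type*} {e : ι → H} {v : H}
    (h : ∀ i, inner 𝕜 (e i) v = 0) : v ∈ (closedSpan 𝕜 e).toSubmoduleᗮ := by
  change v ∈ (Submodule.span 𝕜 (Set.range e)).topologicalClosureᗮ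
  rw [Submodule.orthogonal_closure]
  exact mem_closedPerp.2 h

theorem mem_closedPerp_orthogonal {ι : Type*} (e : ι → H) (i : ι) :
    e i ∈ (closedPerp 𝕜 e).toSubmoduleᗮ :=
  Submodule.le_orthogonal_orthogonal _ (Submodule.subset_span ⟨i, rfl⟩)

theorem Orthonormal.inner_sub_sum {ι : Type*} {e : ι → H} (he : Orthonormal 𝕜 e) (F : Finset ι)
    {v : H} (h : ∀ i ∉ F, inner 𝕜 (e i) v = 0) (i : ι) :
    inner 𝕜 (e i) (v - ∑ j ∈ F, inner 𝕜 (e j) v • e j) = 0 := by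
  classical
  rw [inner_sub_right, inner_sum]
  simp only [inner_smul_right, orthonormal_iff_ite.1 he, mul_ite, mul_one, mul_zero,
    Finset.sum_ite_eq]
  split_ifs with hi
  · simp
  · simp [h i hi]

/-- Projection onto the span of an orthonormal family, for a vector with finitely many nonzero
coefficients. -/
theorem starProjection_closedSpan {ι : Type*} {e : ι → H} (he : Orthonormal 𝕜 e) (F : Finset ι)
    {v : H} (h : ∀ i ∉ F, inner 𝕜 (e i) v = 0) :
    (closedSpan 𝕜 e).toSubmodule.starProjection v = ∑ i ∈ F, inner 𝕜 (e i) v • e i := by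
  apply Submodule.eq_starProjection_of_mem_orthogonal
  · exact Submodule.sum_mem _ fun i _ => Submodule.smul_mem _ _ (mem_closedSpan e i)
  · exact mem_closedSpan_orthogonal (he.inner_sub_sum F h)

theorem starProjection_closedPerp {ι : Type*} {e : ι → H} (he : Orthonormal 𝕜 e) (F : Finset ι)
    {v : H} (h : ∀ i ∉ F, inner 𝕜 (e i) v = 0) :
    (closedPerp 𝕜 e).toSubmodule.starProjection v = v - ∑ i ∈ F, inner 𝕜 (e i) v • e i := by
  apply Submodule.eq_starProjection_of_mem_orthogonal
  · exact mem_closedPerp.2 (he.inner_sub_sum F h)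
  · rw [sub_sub_cancel]
    exact Submodule.sum_mem _ fun i _ => Submodule.smul_mem _ _ (mem_closedPerp_orthogonal e i)

/-- The angle between `e m` and `h m j`; it runs from `0` to `π / 2`. -/
noncomputable def gadgetAngle (m j : ℕ) : ℝ := j * (Real.pi / (2 * gadgetLen m))

theorem gadgetAngle_len (m : ℕ) : gadgetAngle m (gadgetLen m) = Real.pi / 2 := by
  have : (gadgetLen m : ℝ) ≠ 0 := by exact_mod_cast (gadgetLen_pos m).ne'
  rw [gadgetAngle]; field_simp

/-- The coefficient of `e m` in the unit vector `g t`. -/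
noncomputable def slotCoeff (t : ℕ × ℕ) (m : ℕ) : ℝ :=
  if m = t.1 then -Real.sin (gadgetAngle t.1 (t.2 + 1))
  else if m = t.1 + 1 then Real.cos (gadgetAngle t.1 (t.2 + 1)) else 0

variable (𝕜 H) in
/-- The vectors from which the three subspaces are built: `e` is the basis of `E`, the
projection of `x t` to `E` is `√(β t) g t` for each slot `t` in use and `0` for the others, and
`y` provides the directions in which `G` is tilted away from the `x t`. -/
structure SlotFrame (β : ℕ × ℕ → ℝ) where
  e : ℕ → H
  x : ℕ × ℕ → H
  y : ℕ × ℕ → H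
  orthonormal_e : Orthonormal 𝕜 e
  orthonormal_x : Orthonormal 𝕜 x
  orthonormal_y : Orthonormal 𝕜 y
  inner_x_y : ∀ i t, inner 𝕜 (x i) (y t) = 0
  inner_y_e : ∀ t m, inner 𝕜 (y t) (e m) = 0
  inner_x_e : ∀ t m, inner 𝕜 (x t) (e m) =
    if t.2 < gadgetLen t.1 then ((√(β t) * slotCoeff t m : ℝ) : 𝕜) else 0

namespace SlotFrame

variable {β : ℕ × ℕ → ℝ} (S : SlotFrame 𝕜 H β) (lam : ℕ × ℕ → ℝ)

/-- The unit vector orthogonal to `G` in the plane of `x t` and `y t`, chosen such that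
`P_F P_G` multiplies `x t` by `lam t`. -/
noncomputable def z (t : ℕ × ℕ) : H :=
  ((√(1 - lam t) : ℝ) : 𝕜) • S.x t - ((√(lam t) : ℝ) : 𝕜) • S.y t

/-- The three subspaces: `E` is spanned by `e`, `F` is orthogonal to `y`, `G` to `z`. -/
noncomputable def spaces : Fin 3 → ClosedSubmodule 𝕜 H :=
  ![closedSpan 𝕜 S.e, closedPerp 𝕜 S.y, closedPerp 𝕜 (S.z lam)]

/-- The unit vector at angle `gadgetAngle m j` in the plane of `e m` and `e (m + 1)`. -/
noncomputable def h (m j : ℕ) : H :=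
  ((Real.cos (gadgetAngle m j) : ℝ) : 𝕜) • S.e m +
    ((Real.sin (gadgetAngle m j) : ℝ) : 𝕜) • S.e (m + 1)

/-- The unit vector orthogonal to `h m (j + 1)` in the plane of `e m` and `e (m + 1)`, where
`t = (m, j)`. The projection of `h m j` onto its complement is a multiple of `h m (j + 1)`. -/
noncomputable def g (t : ℕ × ℕ) : H :=
  ((-Real.sin (gadgetAngle t.1 (t.2 + 1)) : ℝ) : 𝕜) • S.e t.1 +
    ((Real.cos (gadgetAngle t.1 (t.2 + 1)) : ℝ) : 𝕜) • S.e (t.1 + 1)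

theorem inner_e_e (m m' : ℕ) : inner 𝕜 (S.e m) (S.e m') = if m = m' then 1 else 0 :=
  orthonormal_iff_ite.1 S.orthonormal_e m m'

theorem inner_x_x (i t : ℕ × ℕ) : inner 𝕜 (S.x i) (S.x t) = if i = t then 1 else 0 :=
  orthonormal_iff_ite.1 S.orthonormal_x i t

theorem inner_y_y (i t : ℕ × ℕ) : inner 𝕜 (S.y i) (S.y t) = if i = t then 1 else 0 :=
  orthonormal_iff_ite.1 S.orthonormal_y i t

theorem inner_y_x (i t : ℕ × ℕ) : inner 𝕜 (S.y i) (S.x t) = 0 :=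
  inner_eq_zero_symm.1 (S.inner_x_y t i)

theorem orthonormal_z {lam : ℕ × ℕ → ℝ} (hlam : ∀ t, 0 < lam t ∧ lam t < 1) :
    Orthonormal 𝕜 (S.z lam) := by
  rw [orthonormal_iff_ite]
  intro i t
  simp only [z, inner_sub_left, inner_sub_right, inner_smul_left, inner_smul_right, S.inner_x_x,
    S.inner_y_y, S.inner_x_y, S.inner_y_x, RCLike.conj_ofReal]
  split_ifs with hit
  · subst hit
    have h1 := Real.mul_self_sqrt (hlam i).1.le
    have h2 := Real.mul_self_sqrt (show 0 ≤ 1 - lam i by linarith [(hlam i).2])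
    have : √(1 - lam i) * √(1 - lam i) + √(lam i) * √(lam i) = 1 := by linarith
    have h3 : ((√(1 - lam i) : ℝ) : 𝕜) * ((√(1 - lam i) : ℝ) : 𝕜) +
        ((√(lam i) : ℝ) : 𝕜) * ((√(lam i) : ℝ) : 𝕜) = 1 := by exact_mod_cast this
    linear_combination h3
  · simp

theorem mul_sqrt_one_sub {lam : ℕ × ℕ → ℝ} (hlam : ∀ t, 0 < lam t ∧ lam t < 1) (t : ℕ × ℕ) :
    ((√(1 - lam t) : ℝ) : 𝕜) * ((√(1 - lam t) : ℝ) : 𝕜) = ((1 - lam t : ℝ) : 𝕜) := by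
  rw [← RCLike.ofReal_mul, Real.mul_self_sqrt (by linarith [(hlam t).2])]

theorem starProjection_two_one {lam : ℕ × ℕ → ℝ} (hlam : ∀ t, 0 < lam t ∧ lam t < 1)
    (F : Finset (ℕ × ℕ)) {v : H} (hy : ∀ t, inner 𝕜 (S.y t) v = 0)
    (hx : ∀ t ∉ F, inner 𝕜 (S.x t) v = 0) :
    wordAction (S.spaces lam) [2, 1] v =
      v - ∑ t ∈ F, (((1 - lam t : ℝ) : 𝕜) * inner 𝕜 (S.x t) v) • S.x t := by
  have hz : ∀ t, inner 𝕜 (S.z lam t) v = ((√(1 - lam t) : ℝ) : 𝕜) * inner 𝕜 (S.x t) v := by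
    intro t
    simp only [z, inner_sub_left, inner_smul_left, hy, RCLike.conj_ofReal, mul_zero, sub_zero]
  have h2 : (closedPerp 𝕜 (S.z lam)).toSubmodule.starProjection v =
      v - ∑ t ∈ F, inner 𝕜 (S.z lam t) v • S.z lam t :=
    starProjection_closedPerp (S.orthonormal_z hlam) F fun t ht => by rw [hz, hx t ht, mul_zero]
  have hPx : ∀ t, (closedPerp 𝕜 S.y).toSubmodule.starProjection (S.x t) = S.x t := fun t =>
    Submodule.starProjection_eq_self_iff.2 (mem_closedPerp.2 fun i => S.inner_y_x i t)
  have hPy : ∀ t, (closedPerp 𝕜 S.y).toSubmodule.starProjection (S.y t) = 0 := fun t =>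
    (Submodule.starProjection_apply_eq_zero_iff _).2 (mem_closedPerp_orthogonal _ _)
  have hPv : (closedPerp 𝕜 S.y).toSubmodule.starProjection v = v :=
    Submodule.starProjection_eq_self_iff.2 (mem_closedPerp.2 hy)
  change (closedPerp 𝕜 S.y).toSubmodule.starProjection
    ((closedPerp 𝕜 (S.z lam)).toSubmodule.starProjection v) = _
  rw [h2, map_sub, map_sum, hPv]
  congr 1
  refine Finset.sum_congr rfl fun t _ => ?_
  rw [map_smul, z, map_sub, map_smul, map_smul, hPx, hPy, smul_zero, sub_zero, smul_smul]
  have := hz t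
  rw [z] at this
  rw [this, ← mul_sqrt_one_sub hlam]
  ring_nf

theorem wordAction_two_one_pow {lam : ℕ × ℕ → ℝ} (hlam : ∀ t, 0 < lam t ∧ lam t < 1)
    (F : Finset (ℕ × ℕ)) {v : H} (hy : ∀ t, inner 𝕜 (S.y t) v = 0)
    (hx : ∀ t ∉ F, inner 𝕜 (S.x t) v = 0) (s : ℕ) :
    (wordAction (S.spaces lam) [2, 1])^[s] v =
      v - ∑ t ∈ F, (((1 - lam t ^ s : ℝ) : 𝕜) * inner 𝕜 (S.x t) v) • S.x t := by
  induction s with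
  | zero => simp
  | succ s ih =>
    have hxs : ∀ i, inner 𝕜 (S.x i) (v - ∑ t ∈ F, (((1 - lam t ^ s : ℝ) : 𝕜) *
        inner 𝕜 (S.x t) v) • S.x t) = ((lam i ^ s : ℝ) : 𝕜) * inner 𝕜 (S.x i) v := by
      intro i
      rw [inner_sub_right, inner_sum]
      simp only [inner_smul_right, S.inner_x_x, mul_ite, mul_one, mul_zero, Finset.sum_ite_eq]
      split_ifs with hi
      · push_cast; ring
      · simp [hx i hi]
    rw [Function.iterate_succ_apply', ih, S.starProjection_two_one hlam F]
    · simp only [hxs]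
      rw [sub_sub, ← Finset.sum_add_distrib]
      congr 1
      refine Finset.sum_congr rfl fun t _ => ?_
      rw [← add_smul]
      congr 1
      push_cast
      ring
    · intro t
      rw [inner_sub_right, inner_sum, hy]
      simp [inner_smul_right, S.inner_y_x]
    · intro t ht
      rw [hxs, hx t ht, mul_zero]

theorem inner_g_e (t : ℕ × ℕ) (m : ℕ) : inner 𝕜 (S.g t) (S.e m) = ((slotCoeff t m : ℝ) : 𝕜) := by
  simp only [g, inner_add_left, inner_smul_left, S.inner_e_e, RCLike.conj_ofReal, slotCoeff]
  by_cases h1 : m = t.1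
  · subst h1; simp
  · by_cases h2 : m = t.1 + 1
    · subst h2; simp
    · simp [h1, h2, Ne.symm h1, Ne.symm h2]

theorem norm_g (t : ℕ × ℕ) : ‖S.g t‖ = 1 := by
  have : inner 𝕜 (S.g t) (S.g t) = (1 : 𝕜) := by
    nth_rw 2 [g]
    rw [inner_add_right, inner_smul_right, inner_smul_right, inner_g_e, inner_g_e]
    simp only [slotCoeff]
    have := Real.sin_sq_add_cos_sq (gadgetAngle t.1 (t.2 + 1))
    have h3 : ((Real.sin (gadgetAngle t.1 (t.2 + 1)) : ℝ) : 𝕜) ^ 2 +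
      ((Real.cos (gadgetAngle t.1 (t.2 + 1)) : ℝ) : 𝕜) ^ 2 = 1 := by exact_mod_cast this
    simp
    linear_combination h3
  rw [← sq_eq_sq₀ (norm_nonneg _) zero_le_one, one_pow]
  rw [inner_self_eq_norm_sq_to_K] at this
  exact_mod_cast this

theorem norm_h_le (m j : ℕ) : ‖S.h m j‖ ≤ 1 := by
  have : inner 𝕜 (S.h m j) (S.h m j) = (1 : 𝕜) := by
    simp only [h, inner_add_left, inner_add_right, inner_smul_left, inner_smul_right, S.inner_e_e,
      RCLike.conj_ofReal]
    have := Real.sin_sq_add_cos_sq (gadgetAngle m j)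
    have h3 : ((Real.sin (gadgetAngle m j) : ℝ) : 𝕜) ^ 2 +
      ((Real.cos (gadgetAngle m j) : ℝ) : 𝕜) ^ 2 = 1 := by exact_mod_cast this
    simp
    linear_combination h3
  rw [inner_self_eq_norm_sq_to_K] at this
  have h1 : ‖S.h m j‖ ^ 2 = 1 := by exact_mod_cast this
  nlinarith [norm_nonneg (S.h m j)]

theorem inner_g_h (t : ℕ × ℕ) : inner 𝕜 (S.g t) (S.h t.1 (t.2 + 1)) = 0 := by
  rw [h, inner_add_right, inner_smul_right, inner_smul_right, inner_g_e, inner_g_e]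
  simp only [slotCoeff]
  simp
  ring

theorem starProjection_x {t : ℕ × ℕ} (ht : t.2 < gadgetLen t.1) :
    (closedSpan 𝕜 S.e).toSubmodule.starProjection (S.x t) = ((√(β t) : ℝ) : 𝕜) • S.g t := by
  have hinner : ∀ m, inner 𝕜 (S.e m) (S.x t) = ((√(β t) * slotCoeff t m : ℝ) : 𝕜) := by
    intro m
    rw [← inner_conj_symm, S.inner_x_e, if_pos ht, RCLike.conj_ofReal]
  rw [starProjection_closedSpan S.orthonormal_e {t.1, t.1 + 1}]
  · rw [Finset.sum_pair (by omega), hinner, hinner, g]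
    simp only [slotCoeff]
    simp [smul_smul]
  · intro m hm
    simp only [Finset.mem_insert, Finset.mem_singleton, not_or] at hm
    rw [hinner, slotCoeff, if_neg hm.1, if_neg hm.2]
    simp

end SlotFrame
end Frame

/-! ### Rotating one basis vector into the next -/

section Motion

set_option linter.unusedSectionVars false

variable {𝕜 H : Type*} [RCLike 𝕜] [NormedAddCommGroup H] [InnerProductSpace 𝕜 H] [CompleteSpace H]

namespace SlotFrame

variable {β lam : ℕ × ℕ → ℝ} (S : SlotFrame 𝕜 H β)

/-- The plane in which the gadget `m` rotates. -/
noncomputable def plane (m : ℕ) : Submodule 𝕜 H := Submodule.span 𝕜 {S.e m, S.e (m + 1)}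

theorem inner_x_of_mem_plane {m : ℕ} {v : H} (hv : v ∈ S.plane m) (i : ℕ × ℕ) :
    inner 𝕜 (S.x i) v =
      if i ∈ nearSlots m then ((√(β i) : ℝ) : 𝕜) * inner 𝕜 (S.g i) v else 0 := by
  have base : ∀ m', m' = m ∨ m' = m + 1 → inner 𝕜 (S.x i) (S.e m') =
      if i ∈ nearSlots m then ((√(β i) : ℝ) : 𝕜) * inner 𝕜 (S.g i) (S.e m') else 0 := by
    intro m' hm'
    rw [S.inner_x_e, S.inner_g_e]
    simp only [mem_nearSlots]
    by_cases hi : i.2 < gadgetLen i.1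
    · by_cases hnear : i.1 ≤ m + 1 ∧ m ≤ i.1 + 1
      · rw [if_pos hi, if_pos ⟨hnear.1, hnear.2, hi⟩]; push_cast; rfl
      · rw [if_pos hi, if_neg (fun h => hnear ⟨h.1, h.2.1⟩), slotCoeff, if_neg (by omega),
          if_neg (by omega)]
        simp
    · rw [if_neg hi, if_neg (fun h => hi h.2.2)]
  obtain ⟨a, b, rfl⟩ := Submodule.mem_span_pair.1 hv
  simp only [inner_add_right, inner_smul_right, base m (Or.inl rfl), base (m + 1) (Or.inr rfl)]
  split_ifs <;> ring

theorem h_mem_plane (m j : ℕ) : S.h m j ∈ S.plane m :=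
  Submodule.mem_span_pair.2 ⟨_, _, rfl⟩

theorem g_mem_plane (t : ℕ × ℕ) : S.g t ∈ S.plane t.1 :=
  Submodule.mem_span_pair.2 ⟨_, _, rfl⟩

/-- On the plane of the gadget `m`, the operator `P_E (P_F P_G) ^ s` differs from the identity
by a finite sum over the slots that interact with the plane. -/
theorem wordAction_cycleWord (hβ : ∀ t, 0 < β t) (hlam : ∀ t, 0 < lam t ∧ lam t < 1) (s : ℕ)
    {m : ℕ} {v : H} (hv : v ∈ S.plane m) :
    wordAction (S.spaces lam) (cycleWord s) v =
      v - ∑ i ∈ nearSlots m, (((1 - lam i ^ s) * β i : ℝ) : 𝕜) • (inner 𝕜 (S.g i) v • S.g i) := by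
  obtain ⟨a, b, hab⟩ := Submodule.mem_span_pair.1 hv
  have hy : ∀ t, inner 𝕜 (S.y t) v = 0 := fun t => by
    rw [← hab, inner_add_right, inner_smul_right, inner_smul_right, S.inner_y_e, S.inner_y_e]
    simp
  have hx : ∀ t ∉ nearSlots m, inner 𝕜 (S.x t) v = 0 := fun t ht => by
    rw [S.inner_x_of_mem_plane hv, if_neg ht]
  have hPv : (closedSpan 𝕜 S.e).toSubmodule.starProjection v = v := by
    rw [Submodule.starProjection_eq_self_iff, ← hab]
    exact Submodule.add_mem _ (Submodule.smul_mem _ _ (mem_closedSpan _ _))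
      (Submodule.smul_mem _ _ (mem_closedSpan _ _))
  rw [cycleWord, wordAction_append, wordAction_replicate, S.wordAction_two_one_pow hlam _ hy hx]
  change (closedSpan 𝕜 S.e).toSubmodule.starProjection _ = _
  rw [map_sub, map_sum, hPv]
  congr 1
  refine Finset.sum_congr rfl fun i hi => ?_
  rw [map_smul, S.starProjection_x (mem_nearSlots.1 hi).2.2, S.inner_x_of_mem_plane hv, if_pos hi,
    smul_smul, smul_smul]
  congr 1
  have h2 : ((√(β i) : ℝ) : 𝕜) * ((√(β i) : ℝ) : 𝕜) = ((β i : ℝ) : 𝕜) := by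
    rw [← RCLike.ofReal_mul, Real.mul_self_sqrt (hβ i).le]
  rw [RCLike.ofReal_mul, ← h2]
  ring

theorem mem_nearSlots_self {t : ℕ × ℕ} (ht : t.2 < gadgetLen t.1) : t ∈ nearSlots t.1 :=
  mem_nearSlots.2 ⟨by omega, by omega, ht⟩

/-- On the plane of its gadget, `P_E (P_F P_G) ^ s` is close to the operator that fixes
`h m (j + 1)` and multiplies `g t` by `1 - β t`. -/
theorem norm_cycleWord_sub_le (hβ : ∀ t, 0 < β t) (hlam : ∀ t, 0 < lam t ∧ lam t < 1) (s : ℕ)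
    {t : ℕ × ℕ} (ht : t.2 < gadgetLen t.1) (p q : ℝ) :
    ‖wordAction (S.spaces lam) (cycleWord s) ((p : 𝕜) • S.h t.1 (t.2 + 1) + (q : 𝕜) • S.g t) -
      ((p : 𝕜) • S.h t.1 (t.2 + 1) + (((1 - β t) * q : ℝ) : 𝕜) • S.g t)‖ ≤
      (lam t ^ s * β t + ∑ i ∈ (nearSlots t.1).erase t, (1 - lam i ^ s) * β i) * (|p| + |q|) := by
  set v : H := (p : 𝕜) • S.h t.1 (t.2 + 1) + (q : 𝕜) • S.g t with hv
  have hvp : v ∈ S.plane t.1 := Submodule.add_mem _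
    (Submodule.smul_mem _ _ (S.h_mem_plane _ _)) (Submodule.smul_mem _ _ (S.g_mem_plane _))
  have hgv : inner 𝕜 (S.g t) v = (q : 𝕜) := by
    rw [hv, inner_add_right, inner_smul_right, inner_smul_right, S.inner_g_h,
      inner_self_eq_norm_sq_to_K, S.norm_g]
    simp
  have hnv : ‖v‖ ≤ |p| + |q| := by
    refine (norm_add_le _ _).trans ?_
    rw [norm_smul, norm_smul, S.norm_g, RCLike.norm_ofReal, RCLike.norm_ofReal, mul_one]
    gcongr
    exact mul_le_of_le_one_right (abs_nonneg p) (S.norm_h_le _ _)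
  have hpow : ∀ i, 0 ≤ lam i ^ s ∧ lam i ^ s ≤ 1 := fun i =>
    ⟨pow_nonneg (hlam i).1.le _, pow_le_one₀ (hlam i).1.le (hlam i).2.le⟩
  have hterm : ∀ i, ‖(((1 - lam i ^ s) * β i : ℝ) : 𝕜) • (inner 𝕜 (S.g i) v • S.g i)‖ ≤
      (1 - lam i ^ s) * β i * (|p| + |q|) := by
    intro i
    have h0 : 0 ≤ (1 - lam i ^ s) * β i := mul_nonneg (by linarith [(hpow i).2]) (hβ i).le
    rw [norm_smul, norm_smul, RCLike.norm_ofReal, abs_of_nonneg h0, S.norm_g, mul_one]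
    apply mul_le_mul_of_nonneg_left _ h0
    have := norm_inner_le_norm (𝕜 := 𝕜) (S.g i) v
    rw [S.norm_g, one_mul] at this
    exact this.trans hnv
  rw [S.wordAction_cycleWord hβ hlam s hvp, ← Finset.add_sum_erase _ _ (mem_nearSlots_self ht), hgv]
  have heq : v - ((((1 - lam t ^ s) * β t : ℝ) : 𝕜) • ((q : 𝕜) • S.g t) +
      ∑ i ∈ (nearSlots t.1).erase t,
        (((1 - lam i ^ s) * β i : ℝ) : 𝕜) • (inner 𝕜 (S.g i) v • S.g i)) -
      ((p : 𝕜) • S.h t.1 (t.2 + 1) + (((1 - β t) * q : ℝ) : 𝕜) • S.g t) =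
      ((lam t ^ s * β t * q : ℝ) : 𝕜) • S.g t - ∑ i ∈ (nearSlots t.1).erase t,
        (((1 - lam i ^ s) * β i : ℝ) : 𝕜) • (inner 𝕜 (S.g i) v • S.g i) := by
    rw [hv]
    push_cast
    module
  rw [heq, add_mul, Finset.sum_mul]
  refine (norm_sub_le _ _).trans (add_le_add ?_ ?_)
  · rw [norm_smul, S.norm_g, mul_one, RCLike.norm_ofReal, abs_mul,
      abs_of_nonneg (mul_nonneg (hpow t).1 (hβ t).le)]
    exact mul_le_mul_of_nonneg_left (by linarith [abs_nonneg p])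
      (mul_nonneg (hpow t).1 (hβ t).le)
  · exact (norm_sum_le _ _).trans (Finset.sum_le_sum fun i _ => hterm i)

/-- The errors of the repetitions add up, because the approximating operator preserves the plane
and the actual one is a contraction. -/
theorem norm_cycleWord_iterate_sub_le (hβ : ∀ t, 0 < β t ∧ β t ≤ 1)
    (hlam : ∀ t, 0 < lam t ∧ lam t < 1) (s : ℕ)
    {t : ℕ × ℕ} (ht : t.2 < gadgetLen t.1) (p q : ℝ) (n : ℕ) :
    ‖(wordAction (S.spaces lam) (cycleWord s))^[n]
        ((p : 𝕜) • S.h t.1 (t.2 + 1) + (q : 𝕜) • S.g t) -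
      ((p : 𝕜) • S.h t.1 (t.2 + 1) + (((1 - β t) ^ n * q : ℝ) : 𝕜) • S.g t)‖ ≤
      n * (lam t ^ s * β t + ∑ i ∈ (nearSlots t.1).erase t, (1 - lam i ^ s) * β i) *
        (|p| + |q|) := by
  set κ := lam t ^ s * β t + ∑ i ∈ (nearSlots t.1).erase t, (1 - lam i ^ s) * β i with hκ
  have hκ0 : 0 ≤ κ := by
    have hpow : ∀ i, 0 ≤ lam i ^ s ∧ lam i ^ s ≤ 1 := fun i =>
      ⟨pow_nonneg (hlam i).1.le _, pow_le_one₀ (hlam i).1.le (hlam i).2.le⟩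
    exact add_nonneg (mul_nonneg (hpow t).1 (hβ t).1.le) (Finset.sum_nonneg fun i _ =>
      mul_nonneg (by linarith [(hpow i).2]) (hβ i).1.le)
  induction n with
  | zero => simp
  | succ n ih =>
    rw [Function.iterate_succ_apply']
    have h1 := norm_wordAction_sub_le (S.spaces lam) (cycleWord s) _ _ |>.trans ih
    have h2 := S.norm_cycleWord_sub_le (fun t => (hβ t).1) hlam s ht p ((1 - β t) ^ n * q)
    rw [← mul_assoc, ← pow_succ'] at h2
    have h3 : |(1 - β t) ^ n * q| ≤ |q| := by
      rw [abs_mul, abs_of_nonneg (pow_nonneg (by linarith [(hβ t).2]) n)]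
      exact mul_le_of_le_one_left (abs_nonneg q)
        (pow_le_one₀ (by linarith [(hβ t).2]) (by linarith [(hβ t).1]))
    have h4 : κ * (|p| + |(1 - β t) ^ n * q|) ≤ κ * (|p| + |q|) :=
      mul_le_mul_of_nonneg_left (by linarith) hκ0
    refine (norm_sub_le_norm_sub_add_norm_sub _ _ _).trans ((add_le_add h1 (h2.trans h4)).trans ?_)
    push_cast
    linarith

theorem h_eq (m j : ℕ) :
    S.h m j = ((Real.cos (Real.pi / (2 * gadgetLen m)) : ℝ) : 𝕜) • S.h m (j + 1) +
      ((-Real.sin (Real.pi / (2 * gadgetLen m)) : ℝ) : 𝕜) • S.g (m, j) := by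
  have hangle : gadgetAngle m j = gadgetAngle m (j + 1) - Real.pi / (2 * gadgetLen m) := by
    rw [gadgetAngle, gadgetAngle]; push_cast; ring
  have hc : Real.cos (gadgetAngle m j) = Real.cos (Real.pi / (2 * gadgetLen m)) *
      Real.cos (gadgetAngle m (j + 1)) + -Real.sin (Real.pi / (2 * gadgetLen m)) *
      -Real.sin (gadgetAngle m (j + 1)) := by
    rw [hangle, Real.cos_sub]; ring
  have hs : Real.sin (gadgetAngle m j) = Real.cos (Real.pi / (2 * gadgetLen m)) *
      Real.sin (gadgetAngle m (j + 1)) + -Real.sin (Real.pi / (2 * gadgetLen m)) *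
      Real.cos (gadgetAngle m (j + 1)) := by
    rw [hangle, Real.sin_sub]; ring
  rw [h, hc, hs, h, g]
  push_cast
  module

/-- The word of the slot `(m, j)` moves `h m j` close to `h m (j + 1)`: the three parts of the
error are the deviation from `1 - β g g*`, the remaining `g`-component, and the loss of norm
`1 - cos θ` of an exact projection. -/
theorem norm_slotWord_sub_le (hβ : ∀ t, 0 < β t ∧ β t ≤ 1)
    (hlam : ∀ t, 0 < lam t ∧ lam t < 1) {s r m j : ℕ} (hj : j < gadgetLen m) {ε : ℝ}
    (h1 : (1 - β (m, j)) ^ r ≤ ε)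
    (h2 : r * (lam (m, j) ^ s * β (m, j) +
      ∑ i ∈ (nearSlots m).erase (m, j), (1 - lam i ^ s) * β i) ≤ ε) :
    ‖wordAction (S.spaces lam) (slotWord s r) (S.h m j) - S.h m (j + 1)‖ ≤
      3 * ε + 2 / gadgetLen m ^ 2 := by
  set θ := Real.pi / (2 * gadgetLen m) with hθ
  have hK : (0 : ℝ) < gadgetLen m := by exact_mod_cast gadgetLen_pos m
  have key := S.norm_cycleWord_iterate_sub_le hβ hlam s (t := (m, j)) hj (Real.cos θ)
    (-Real.sin θ) r
  rw [slotWord, wordAction_replicate, S.h_eq m j]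
  have hε : 0 ≤ ε := (pow_nonneg (by linarith [(hβ (m, j)).2]) r).trans h1
  have hcs : |Real.cos θ| + |-Real.sin θ| ≤ 2 := by
    rw [abs_neg]; linarith [Real.abs_cos_le_one θ, Real.abs_sin_le_one θ]
  have k1 := key.trans (mul_le_mul h2 hcs (by positivity) hε)
  have hcos : 1 - Real.cos θ ≤ 2 / gadgetLen m ^ 2 := by
    have := Real.one_sub_sq_div_two_le_cos (x := θ)
    have h4 : θ ^ 2 / 2 ≤ 2 / gadgetLen m ^ 2 := by
      have : θ ^ 2 / 2 = (Real.pi ^ 2 / 8) / gadgetLen m ^ 2 := by rw [hθ]; field_simp; ring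
      rw [this]
      gcongr
      nlinarith [Real.pi_lt_four, Real.pi_pos]
    linarith
  have k2 : ‖((Real.cos θ : ℝ) : 𝕜) • S.h m (j + 1) +
      (((1 - β (m, j)) ^ r * -Real.sin θ : ℝ) : 𝕜) • S.g (m, j) - S.h m (j + 1)‖ ≤
      2 / gadgetLen m ^ 2 + ε := by
    have : ((Real.cos θ : ℝ) : 𝕜) • S.h m (j + 1) +
      (((1 - β (m, j)) ^ r * -Real.sin θ : ℝ) : 𝕜) • S.g (m, j) - S.h m (j + 1) =
      ((Real.cos θ - 1 : ℝ) : 𝕜) • S.h m (j + 1) +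
      (((1 - β (m, j)) ^ r * -Real.sin θ : ℝ) : 𝕜) • S.g (m, j) := by
      push_cast; module
    rw [this]
    refine (norm_add_le _ _).trans (add_le_add ?_ ?_)
    · rw [norm_smul, RCLike.norm_ofReal, abs_sub_comm,
        abs_of_nonneg (by linarith [Real.cos_le_one θ])]
      exact (mul_le_of_le_one_right (by linarith [Real.cos_le_one θ]) (S.norm_h_le _ _)).trans hcos
    · rw [norm_smul, RCLike.norm_ofReal, S.norm_g, mul_one, abs_mul, abs_neg,
        abs_of_nonneg (pow_nonneg (by linarith [(hβ (m, j)).2]) r)]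
      exact (mul_le_of_le_one_right (pow_nonneg (by linarith [(hβ (m, j)).2]) r)
        (Real.abs_sin_le_one θ)).trans h1
  refine (norm_sub_le_norm_sub_add_norm_sub _ _ _).trans ((add_le_add k1 k2).trans ?_)
  linarith

theorem norm_gadgetWord_sub_le (hβ : ∀ t, 0 < β t ∧ β t ≤ 1)
    (hlam : ∀ t, 0 < lam t ∧ lam t < 1) {s r : ℕ × ℕ → ℕ} {m : ℕ}
    (hsr : ∀ t : ℕ × ℕ, t.2 < gadgetLen t.1 →
        (1 - β t) ^ r t ≤ 1 / (gadgetLen t.1 : ℝ) ^ 2 ∧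
        r t * (lam t ^ s t * β t +
          ∑ i ∈ (nearSlots t.1).erase t, (1 - lam i ^ s t) * β i) ≤
            1 / (gadgetLen t.1 : ℝ) ^ 2) :
    ‖wordAction (S.spaces lam) (gadgetWord s r m) (S.e m) - S.e (m + 1)‖ ≤ 5 / gadgetLen m := by
  have hK : (0 : ℝ) < gadgetLen m := by exact_mod_cast gadgetLen_pos m
  have key : ∀ n ≤ gadgetLen m, ‖wordAction (S.spaces lam)
      ((List.range n).map fun j => slotWord (s (m, j)) (r (m, j))).flatten (S.h m 0) - S.h m n‖ ≤
      n * (5 / (gadgetLen m : ℝ) ^ 2) := by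
    intro n hn
    induction n with
    | zero => simp [wordAction]
    | succ n ih =>
      rw [List.range_succ, List.map_append, List.flatten_append, wordAction_append]
      have h1 := (norm_wordAction_sub_le (S.spaces lam) (slotWord (s (m, n)) (r (m, n))) _ _).trans
        (ih (by omega))
      have h2 := S.norm_slotWord_sub_le hβ hlam (s := s (m, n)) (r := r (m, n)) (by omega)
        (hsr (m, n) (by simpa using hn)).1 (hsr (m, n) (by simpa using hn)).2
      simp only [List.map_cons, List.map_nil, List.flatten_cons, List.flatten_nil, List.append_nil]
      refine (norm_sub_le_norm_sub_add_norm_sub _ _ _).trans ((add_le_add h1 h2).trans ?_)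
      push_cast
      apply le_of_eq
      ring
  have h0 : S.h m 0 = S.e m := by simp [h, gadgetAngle]
  have h1 : S.h m (gadgetLen m) = S.e (m + 1) := by simp [h, gadgetAngle_len]
  have := key _ le_rfl
  rw [h0, h1] at this
  refine this.trans (le_of_eq ?_)
  field_simp

/-- At the beginning of the gadget `m` the iterate is close to `d • e m`; the bound is a partial
sum of the geometric series `∑ 5 / 2 ^ (i + 4) = 5 / 8`. -/
theorem norm_prefixWord_sub_le (hβ : ∀ t, 0 < β t ∧ β t ≤ 1)
    (hlam : ∀ t, 0 < lam t ∧ lam t < 1) {s r : ℕ × ℕ → ℕ}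
    (hsr : ∀ t : ℕ × ℕ, t.2 < gadgetLen t.1 →
        (1 - β t) ^ r t ≤ 1 / (gadgetLen t.1 : ℝ) ^ 2 ∧
        r t * (lam t ^ s t * β t +
          ∑ i ∈ (nearSlots t.1).erase t, (1 - lam i ^ s t) * β i) ≤
            1 / (gadgetLen t.1 : ℝ) ^ 2)
    {w : H} {d : 𝕜} (hw : (closedSpan 𝕜 S.e).toSubmodule.starProjection w = d • S.e 0) (m : ℕ) :
    ‖wordAction (S.spaces lam) (prefixWord s r m) w - d • S.e m‖ ≤
      ‖d‖ * (5 / 8 * (1 - 1 / 2 ^ m)) := by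
  have hsmul : ∀ (l : List (Fin 3)) (v : H), wordAction (S.spaces lam) l (d • v) =
      d • wordAction (S.spaces lam) l v := by
    intro l
    induction l with
    | nil => intro v; rfl
    | cons i l ih =>
      intro v
      change wordAction _ l ((S.spaces lam i).toSubmodule.starProjection (d • v)) = _
      rw [map_smul, ih]
      rfl
  induction m with
  | zero =>
    change ‖(closedSpan 𝕜 S.e).toSubmodule.starProjection w - _‖ ≤ _
    rw [hw]; simp
  | succ m ih =>
    rw [prefixWord, wordAction_append]
    have h1 := (norm_wordAction_sub_le (S.spaces lam) (gadgetWord s r m) _ _).trans ih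
    have h2 := S.norm_gadgetWord_sub_le hβ hlam (m := m) hsr
    have h3 : ‖wordAction (S.spaces lam) (gadgetWord s r m) (d • S.e m) - d • S.e (m + 1)‖ ≤
        ‖d‖ * (5 / gadgetLen m) := by
      rw [hsmul, ← smul_sub, norm_smul]
      exact mul_le_mul_of_nonneg_left h2 (norm_nonneg d)
    refine (norm_sub_le_norm_sub_add_norm_sub _ _ _).trans ((add_le_add h1 h3).trans ?_)
    rw [← mul_add]
    apply le_of_eq
    rw [gadgetLen]
    push_cast
    field_simp
    ring

/-- The three subspaces intersect trivially: a common vector is orthogonal to all `x t`, and the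
last slot of the gadget `m` has `g t = -e m`. -/
theorem eq_zero_of_mem_spaces (hβ : ∀ t, 0 < β t) (hlam : ∀ t, 0 < lam t ∧ lam t < 1) {v : H}
    (hv : ∀ i, v ∈ S.spaces lam i) : v = 0 := by
  have h0 : v ∈ (closedSpan 𝕜 S.e).toSubmodule := hv 0
  have hy : ∀ t, inner 𝕜 (S.y t) v = 0 := mem_closedPerp.1 (hv 1)
  have hz : ∀ t, inner 𝕜 (S.z lam t) v = 0 := mem_closedPerp.1 (hv 2)
  have hx : ∀ t, inner 𝕜 (S.x t) v = 0 := by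
    intro t
    have h := hz t
    simp only [z, inner_sub_left, inner_smul_left, hy, RCLike.conj_ofReal, mul_zero, sub_zero] at h
    have hne : ((√(1 - lam t) : ℝ) : 𝕜) ≠ 0 := by
      rw [RCLike.ofReal_ne_zero]
      exact (Real.sqrt_pos.2 (by linarith [(hlam t).2])).ne'
    exact (mul_eq_zero.1 h).resolve_left hne
  have he : ∀ m, inner 𝕜 (S.e m) v = 0 := by
    intro m
    have hlt : gadgetLen m - 1 < gadgetLen m := by have := gadgetLen_pos m; omega
    have h1 := S.starProjection_x (t := (m, gadgetLen m - 1)) hlt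
    have h2 : S.g (m, gadgetLen m - 1) = -S.e m := by
      simp [g, Nat.sub_add_cancel (gadgetLen_pos m), gadgetAngle_len]
    have h3 := hx (m, gadgetLen m - 1)
    rw [← Submodule.starProjection_eq_self_iff.2 h0, ← Submodule.inner_starProjection_left_eq_right,
      h1, h2, inner_smul_left, inner_neg_left, RCLike.conj_ofReal] at h3
    have hne : ((√(β (m, gadgetLen m - 1)) : ℝ) : 𝕜) ≠ 0 := by
      rw [RCLike.ofReal_ne_zero]
      exact (Real.sqrt_pos.2 (hβ _)).ne'
    simpa using (mul_eq_zero.1 h3).resolve_left hne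
  exact inner_self_eq_zero.1 (Submodule.inner_right_of_mem_orthogonal h0
    (mem_closedSpan_orthogonal he))

end SlotFrame
end Motion

/-! ### Existence of the configuration -/

section Existence

set_option linter.unusedSectionVars false

variable {𝕜 H : Type*} [RCLike 𝕜] [NormedAddCommGroup H] [InnerProductSpace 𝕜 H] [CompleteSpace H]

/-- In an infinite-dimensional Hilbert space there is an orthonormal family with any given countable
index type and one prescribed member. -/
theorem exists_orthonormal_extending {ι : Type*} [Countable ι] (i₀ : ι)
    (hH : ¬ FiniteDimensional 𝕜 H) {w : H} (hw : ‖w‖ = 1) :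
    ∃ b : ι → H, Orthonormal 𝕜 b ∧ b i₀ = w := by
  classical
  have h1 : Orthonormal 𝕜 ((↑) : ({w} : Set H) → H) := by
    rw [orthonormal_subtype_iff_ite]
    rintro v rfl v' rfl
    rw [if_pos rfl, inner_self_eq_norm_sq_to_K, hw]
    simp
  obtain ⟨s, b, hs, hb⟩ := h1.exists_hilbertBasis_extension
  have hinf : Infinite s := by
    by_contra hfin
    rw [not_infinite_iff_finite] at hfin
    have := Fintype.ofFinite s
    exact hH b.toOrthonormalBasis.toBasis.finiteDimensional_of_finite
  obtain ⟨f, hf⟩ := exists_injective_nat ι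
  let w' : s := ⟨w, hs rfl⟩
  let emb : ι → s := fun i => Infinite.natEmbedding s (f i)
  have hemb : Function.Injective emb := (Infinite.natEmbedding s).injective.comp hf
  -- Swapping two basis vectors puts `w` at the index `i₀`.
  refine ⟨fun i => b (Equiv.swap (emb i₀) w' (emb i)),
    b.orthonormal.comp _ ((Equiv.injective _).comp hemb), ?_⟩
  exact (congrArg b (Equiv.swap_apply_left _ _)).trans (congrFun hb w')

/-- A combination of the vectors `x (m, j)` and `x' (m, j)` with real coefficients
`α j`, `γ j`, over the slots in use of one gadget. -/
noncomputable def gadgetVector (x x' : ℕ × ℕ → H) (m : ℕ) (α γ : ℕ → ℝ) : H :=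
  ∑ j ∈ Finset.range (gadgetLen m), (((α j : ℝ) : 𝕜) • x (m, j) + ((γ j : ℝ) : 𝕜) • x' (m, j))

/-- A frame inside the span of an orthonormal family. Since the `x t` must be orthonormal although
their projections `√(β t) g t` to `E` are not orthogonal, `e m` is written as a combination of the
`x t`: the requirement fixes the coefficient of `x t` in `e m`. To make the `e m` orthonormal, each
`x t` gets a companion `x' t`, with `g t` turned by a right angle, whose contribution cancels the
inner product of `e m` and `e (m + 1)`; a further vector `c m` with a coefficient `a m > 0`
normalizes `e m`. -/
theorem exists_slotFrame {β : ℕ × ℕ → ℝ} (hβ : ∀ t, 0 < β t)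
    (hβ' : ∀ t : ℕ × ℕ, t.2 < gadgetLen t.1 → β t ≤ 1 / (4 * gadgetLen t.1))
    {b : (ℕ × ℕ) × Fin 3 ⊕ ℕ → H} (hb : Orthonormal 𝕜 b) :
    ∃ (S : SlotFrame 𝕜 H β) (a : ℝ), 0 < a ∧
      ∀ m, inner 𝕜 (S.e m) (b (Sum.inr 0)) = if m = 0 then ((a : ℝ) : 𝕜) else 0 := by
  have hbb := orthonormal_iff_ite.1 hb
  let x : ℕ × ℕ → H := fun t => b (Sum.inl (t, 0))
  let x' : ℕ × ℕ → H := fun t => b (Sum.inl (t, 1))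
  let y : ℕ × ℕ → H := fun t => b (Sum.inl (t, 2))
  let c : ℕ → H := fun m => b (Sum.inr m)
  have hxx : ∀ i t, inner 𝕜 (x i) (x t) = if i = t then 1 else 0 := fun i t => by
    simp [x, hbb]
  have hx'x' : ∀ i t, inner 𝕜 (x' i) (x' t) = if i = t then 1 else 0 := fun i t => by
    simp [x', hbb]
  have hxx' : ∀ i t, inner 𝕜 (x i) (x' t) = 0 := fun i t => by simp [x, x', hbb]
  have hx'x : ∀ i t, inner 𝕜 (x' i) (x t) = 0 := fun i t => by simp [x, x', hbb]
  have hyx : ∀ i t, inner 𝕜 (y i) (x t) = 0 := fun i t => by simp [x, y, hbb]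
  have hyx' : ∀ i t, inner 𝕜 (y i) (x' t) = 0 := fun i t => by simp [x', y, hbb]
  have hxy : ∀ i t, inner 𝕜 (x i) (y t) = 0 := fun i t => by simp [x, y, hbb]
  have hcx : ∀ i t, inner 𝕜 (c i) (x t) = 0 := fun i t => by simp [x, c, hbb]
  have hcx' : ∀ i t, inner 𝕜 (c i) (x' t) = 0 := fun i t => by simp [x', c, hbb]
  have hxc : ∀ i t, inner 𝕜 (x i) (c t) = 0 := fun i t => by simp [x, c, hbb]
  have hx'c : ∀ i t, inner 𝕜 (x' i) (c t) = 0 := fun i t => by simp [x', c, hbb]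
  have hyc : ∀ i t, inner 𝕜 (y i) (c t) = 0 := fun i t => by simp [y, c, hbb]
  have hcc : ∀ i t, inner 𝕜 (c i) (c t) = if i = t then 1 else 0 := fun i t => by
    simp [c, hbb]
  let V : ℕ → (ℕ → ℝ) → (ℕ → ℝ) → H := gadgetVector (𝕜 := 𝕜) x x'
  have hVV : ∀ m m' α γ α' γ', inner 𝕜 (V m α γ) (V m' α' γ') = if m = m' then
      ((∑ j ∈ Finset.range (gadgetLen m), (α j * α' j + γ j * γ' j) : ℝ) : 𝕜) else 0 := by
    intro m m' α γ α' γ'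
    simp only [V, gadgetVector, sum_inner, inner_sum, inner_add_left, inner_add_right,
      inner_smul_left, inner_smul_right, hxx, hx'x', hxx', hx'x, RCLike.conj_ofReal, mul_zero,
      add_zero, zero_add, Prod.mk.injEq]
    split_ifs with hm
    · subst hm
      push_cast
      refine Finset.sum_congr rfl fun j hj => ?_
      simp only [true_and, mul_ite, mul_one, mul_zero, Finset.sum_ite_eq', if_pos hj]
      ring
    · simp [hm]
  have hyV : ∀ t m α γ, inner 𝕜 (y t) (V m α γ) = 0 := fun t m α γ => by
    simp [V, gadgetVector, inner_sum, inner_add_right, inner_smul_right, hyx, hyx']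
  have hcV : ∀ i m α γ, inner 𝕜 (c i) (V m α γ) = 0 := fun i m α γ => by
    simp [V, gadgetVector, inner_sum, inner_add_right, inner_smul_right, hcx, hcx']
  have hVc : ∀ i m α γ, inner 𝕜 (V m α γ) (c i) = 0 := fun i m α γ =>
    inner_eq_zero_symm.1 (hcV i m α γ)
  have hxV : ∀ (t : ℕ × ℕ) m α γ, inner 𝕜 (x t) (V m α γ) =
      if t.2 < gadgetLen t.1 then (if m = t.1 then ((α t.2 : ℝ) : 𝕜) else 0) else 0 := by
    rintro ⟨m', j⟩ m α γ
    simp only [V, gadgetVector, inner_sum, inner_add_right, inner_smul_right, hxx, hxx', mul_zero,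
      add_zero, Prod.mk.injEq]
    by_cases hm : m' = m
    · subst hm
      simp only [true_and, mul_ite, mul_one, mul_zero, Finset.sum_ite_eq, Finset.mem_range,
        if_true]
    · simp [hm, Ne.symm hm]
  let sn : ℕ → ℕ → ℝ := fun m j => √(β (m, j)) * Real.sin (gadgetAngle m (j + 1))
  let cs : ℕ → ℕ → ℝ := fun m j => √(β (m, j)) * Real.cos (gadgetAngle m (j + 1))
  let p : ℕ → H := fun m => V m (fun j => -sn m j) (cs m)
  let q : ℕ → H := fun m => V m (cs m) (sn m)
  let T : ℕ → ℝ := fun m => ∑ j ∈ Finset.range (gadgetLen m), β (m, j)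
  have hT0 : ∀ m, 0 ≤ T m := fun m => Finset.sum_nonneg fun j _ => (hβ _).le
  have hT1 : ∀ m, T m ≤ 1 / 4 := by
    intro m
    have hK : (0 : ℝ) < gadgetLen m := by exact_mod_cast gadgetLen_pos m
    calc T m ≤ ∑ j ∈ Finset.range (gadgetLen m), 1 / (4 * (gadgetLen m : ℝ)) :=
          Finset.sum_le_sum fun j hj => hβ' (m, j) (Finset.mem_range.1 hj)
      _ = 1 / 4 := by
          rw [Finset.sum_const, Finset.card_range, nsmul_eq_mul]; field_simp
  have hsq : ∀ m j, sn m j * sn m j + cs m j * cs m j = β (m, j) := by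
    intro m j
    have h1 := Real.mul_self_sqrt (hβ (m, j)).le
    have h2 := Real.sin_sq_add_cos_sq (gadgetAngle m (j + 1))
    simp only [sn, cs]
    linear_combination h1 * 1 + √(β (m, j)) ^ 2 * h2
  have hpp : ∀ m m', inner 𝕜 (p m) (p m') = if m = m' then ((T m : ℝ) : 𝕜) else 0 := by
    intro m m'
    simp only [p, hVV]
    split_ifs with hm
    · subst hm
      congr 1
      refine Finset.sum_congr rfl fun j _ => ?_
      rw [← hsq]; ring
    · rfl
  have hqq : ∀ m m', inner 𝕜 (q m) (q m') = if m = m' then ((T m : ℝ) : 𝕜) else 0 := by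
    intro m m'
    simp only [q, hVV]
    split_ifs with hm
    · subst hm
      congr 1
      refine Finset.sum_congr rfl fun j _ => ?_
      rw [← hsq]; ring
    · rfl
  have hpq : ∀ m m', inner 𝕜 (p m) (q m') = 0 := by
    intro m m'
    simp only [p, q, hVV]
    split_ifs with hm
    · subst hm
      rw [Finset.sum_eq_zero fun j _ => by ring, RCLike.ofReal_zero]
    · rfl
  have hqp : ∀ m m', inner 𝕜 (q m) (p m') = 0 := fun m m' => inner_eq_zero_symm.1 (hpq m' m)
  have hpc : ∀ m i, inner 𝕜 (p m) (c i) = 0 := fun m i => hVc _ _ _ _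
  have hqc : ∀ m i, inner 𝕜 (q m) (c i) = 0 := fun m i => hVc _ _ _ _
  have hcp : ∀ m i, inner 𝕜 (c m) (p i) = 0 := fun m i => hcV _ _ _ _
  have hcq : ∀ m i, inner 𝕜 (c m) (q i) = 0 := fun m i => hcV _ _ _ _
  -- The part of `e m` that comes from the gadget `m - 1`; there is none for `m = 0`.
  let Q : ℕ → H := fun m => match m with
    | 0 => 0
    | m + 1 => q m
  let U : ℕ → ℝ := fun m => match m with
    | 0 => 0
    | m + 1 => T m
  have hU0 : ∀ m, 0 ≤ U m := fun m => by cases m with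
    | zero => exact le_rfl
    | succ m => exact hT0 m
  have hU1 : ∀ m, U m ≤ 1 / 4 := fun m => by cases m with
    | zero => norm_num [U]
    | succ m => exact hT1 m
  have hQQ : ∀ m m', inner 𝕜 (Q m) (Q m') = if m = m' then ((U m : ℝ) : 𝕜) else 0 := by
    intro m m'
    cases m <;> cases m' <;> simp [Q, U, hqq]
  have hpQ : ∀ m m', inner 𝕜 (p m) (Q m') = 0 := fun m m' => by
    cases m' <;> simp [Q, hpq]
  have hQp : ∀ m m', inner 𝕜 (Q m) (p m') = 0 := fun m m' => inner_eq_zero_symm.1 (hpQ m' m)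
  have hQc : ∀ m i, inner 𝕜 (Q m) (c i) = 0 := fun m i => by cases m <;> simp [Q, hqc]
  have hcQ : ∀ m i, inner 𝕜 (c m) (Q i) = 0 := fun m i => inner_eq_zero_symm.1 (hQc i m)
  let a : ℕ → ℝ := fun m => √(1 - T m - U m)
  have ha : ∀ m, ((a m : ℝ) : 𝕜) * ((a m : ℝ) : 𝕜) = 1 - ((T m : ℝ) : 𝕜) - ((U m : ℝ) : 𝕜) := by
    intro m
    rw [← RCLike.ofReal_mul, Real.mul_self_sqrt (by linarith [hT1 m, hU1 m])]
    push_cast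
    rfl
  let e : ℕ → H := fun m => p m + Q m + ((a m : ℝ) : 𝕜) • c m
  refine ⟨⟨e, x, y, ?_, ?_, ?_, hxy, ?_, ?_⟩, a 0, Real.sqrt_pos.2 (by linarith [hT1 0, hU1 0]),
    fun m => ?_⟩
  · rw [orthonormal_iff_ite]
    intro m m'
    simp only [e, inner_add_left, inner_add_right, inner_smul_left, inner_smul_right, hpp, hQQ,
      hpQ, hQp, hpc, hcp, hQc, hcQ, hcc, RCLike.conj_ofReal, mul_zero, add_zero, zero_add]
    split_ifs with hm
    · subst hm
      linear_combination ha m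
    · simp
  · exact orthonormal_iff_ite.2 hxx
  · rw [orthonormal_iff_ite]
    intro i t
    simp [y, hbb]
  · intro t m
    have hyQ : inner 𝕜 (y t) (Q m) = 0 := by cases m <;> simp [Q, q, hyV]
    simp only [e, inner_add_right, inner_smul_right, hyc, hyQ, p, hyV, mul_zero, add_zero]
  · intro t m
    have hxQ : inner 𝕜 (x t) (Q m) = if t.2 < gadgetLen t.1 then
        (if m = t.1 + 1 then ((cs t.1 t.2 : ℝ) : 𝕜) else 0) else 0 := by
      cases m with
      | zero => simp [Q]
      | succ m =>
        simp only [Q, q, hxV, add_left_inj]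
        by_cases hm : m = t.1
        · subst hm; rfl
        · simp [hm]
    simp only [e, inner_add_right, inner_smul_right, hxc, hxQ, p, hxV, mul_zero, add_zero]
    split_ifs with h1 h2 h3 h3
    · omega
    · subst h2
      simp [slotCoeff, sn]
    · subst h3
      simp [slotCoeff, cs]
    · simp [slotCoeff, h2, h3]
    · simp
  · change inner 𝕜 (e m) (c 0) = _
    simp only [e, inner_add_left, inner_smul_left, hpc, hQc, hcc, RCLike.conj_ofReal]
    split_ifs with hm
    · subst hm; simp
    · simp

end Existence

theorem theorem2p6 :
    ∃ k : ℕ → Fin 3,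
      ∀ (𝕜 : Type*) [RCLike 𝕜] (H : Type*) [NormedAddCommGroup H] [InnerProductSpace 𝕜 H]
        [CompleteSpace H],
        ¬ FiniteDimensional 𝕜 H →
        ∀ w₀ : H, w₀ ≠ 0 →
          ∃ X : Fin 3 → ClosedSubmodule 𝕜 H,
            -- the iterates do not converge in norm
            (¬ ∃ x : H, Tendsto (projIterate X k w₀) atTop (𝓝 x)) ∧
            -- the three subspaces meet only at the origin
            (∀ x : H, (∀ i : Fin 3, x ∈ X i) → x = 0) ∧
            -- the iterates converge weakly to the origin
            Tendsto (fun n => toWeakSpace 𝕜 H (projIterate X k w₀ n)) atTop (𝓝 0) ∧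
            -- the iterates stay bounded away from the origin in norm
            (∃ c : ℝ, 0 < c ∧ ∀ n : ℕ, c ≤ ‖projIterate X k w₀ n‖) := by
  obtain ⟨β, lam, s, r, hβ, hβ', hlam, hs, hr, hsr⟩ :=
    exists_parameters (fun m => 1 / (gadgetLen m : ℝ) ^ 2) fun m => by
      have := gadgetLen_pos m; positivity
  refine ⟨letters s r, fun 𝕜 _ H _ _ _ hH w₀ hw₀ => ?_⟩
  have hw0 : 0 < ‖w₀‖ := norm_pos_iff.2 hw₀
  have hunit : ‖((‖w₀‖⁻¹ : ℝ) : 𝕜) • w₀‖ = 1 := by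
    rw [norm_smul, RCLike.norm_ofReal, abs_of_pos (inv_pos.2 hw0), inv_mul_cancel₀ hw0.ne']
  obtain ⟨b, hb, hb0⟩ := exists_orthonormal_extending (𝕜 := 𝕜)
    (ι := (ℕ × ℕ) × Fin 3 ⊕ ℕ) (Sum.inr 0) hH hunit
  obtain ⟨S, a, ha, hSa⟩ := exists_slotFrame (fun t => (hβ t).1) hβ' hb
  have hw : w₀ = ((‖w₀‖ : ℝ) : 𝕜) • b (Sum.inr 0) := by
    rw [hb0, smul_smul, ← RCLike.ofReal_mul, mul_inv_cancel₀ hw0.ne', RCLike.ofReal_one, one_smul]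
  -- The starting vector lies outside `E`, and its projection to `E` is a multiple of `e 0`.
  have hd : (closedSpan 𝕜 S.e).toSubmodule.starProjection w₀ =
      ((‖w₀‖ * a : ℝ) : 𝕜) • S.e 0 := by
    rw [hw, map_smul, starProjection_closedSpan S.orthonormal_e {0}
      fun m hm => by rw [hSa, if_neg (by simpa using hm)], Finset.sum_singleton, hSa, if_pos rfl,
      smul_smul, norm_smul, hb.1, RCLike.norm_ofReal, abs_norm, mul_one, RCLike.ofReal_mul]
  have hda : 0 < ‖w₀‖ * a := mul_pos hw0 ha
  have hX := fun v => S.eq_zero_of_mem_spaces (fun t => (hβ t).1) hlam (v := v)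
  have hweak := tendsto_inner_projIterate (S.spaces lam) w₀ (letters_follows hs hr)
    (exists_letters_eq_zero hs hr) fun v hv => hX v hv
  have hbound : ∀ n, ‖w₀‖ * a * (3 / 8) ≤ ‖projIterate (S.spaces lam) (letters s r) w₀ n‖ := by
    intro n
    have h1 := norm_projIterate_antitone (S.spaces lam) (letters s r) w₀
      (prefixWord_length_lt s hr n).le
    have h2 := projIterate_eq_wordAction (S.spaces lam) (letters s r) w₀ (prefixWord s r n)
      fun i hi => letters_eq s hr n i hi
    have h3 := S.norm_prefixWord_sub_le hβ hlam hsr hd n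
    beta_reduce at h1
    rw [h2] at h1
    have h4 : ‖((‖w₀‖ * a : ℝ) : 𝕜) • S.e n‖ = ‖w₀‖ * a := by
      rw [norm_smul, S.orthonormal_e.1, RCLike.norm_ofReal, abs_of_pos hda, mul_one]
    rw [RCLike.norm_ofReal, abs_of_pos hda, norm_sub_rev] at h3
    have h5 := norm_sub_norm_le (((‖w₀‖ * a : ℝ) : 𝕜) • S.e n)
      (wordAction (S.spaces lam) (prefixWord s r n) w₀)
    have h6 : ‖w₀‖ * a * (5 / 8 * (1 - 1 / 2 ^ n)) ≤ ‖w₀‖ * a * (5 / 8) := by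
      apply mul_le_mul_of_nonneg_left _ hda.le
      have : (0 : ℝ) < 1 / 2 ^ n := by positivity
      linarith
    linarith
  refine ⟨S.spaces lam, ?_, fun v hv => hX v hv, tendsto_toWeakSpace hweak,
    ‖w₀‖ * a * (3 / 8), by positivity, hbound⟩
  rintro ⟨v, hv⟩
  have h1 : inner 𝕜 v v = (0 : 𝕜) :=
    tendsto_nhds_unique (tendsto_const_nhds.inner hv) (hweak v)
  have h2 : v = 0 := inner_self_eq_zero.1 h1
  have h3 := ge_of_tendsto' hv.norm hbound
  rw [h2, norm_zero] at h3
  have : 0 < ‖w₀‖ * a * (3 / 8) := by positivity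
  linarith
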